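/- Let $p\in[0,1]$ and let $(B_{ij})_{i,j\ge 0}$, $(\xi_{ij})_{i,j\ge 0}$, $(\eta_{ij})_{i,j\ge 0}$ be random variables on a probability space, all of them mutually independent, such that each $B_{ij}$ is Bernoulli($p$), the $\xi_{ij}$ are non-negative and integrable with a common distribution, and the $\eta_{ij}$ are non-negative and integrable with a common (possibly different) distribution. In the generalized Seppäläinen–Johansson model the horizontal edge $(i-1,j)\to(i,j)$ of $\mathbb Z_{\ge 0}^2$ has weight $B_{ij}\xi_{ij}$ and the vertical edge $(i,j-1)\to(i,j)$ has weight $(1-B_{ij})\eta_{ij}$. Let $F(m,n)$ be the minimum, over all up-right lattice paths from $(0,0)$ to $(m,n)$, of the sum of the weights of the edges traversed. Let $F_H(m,n)$ be the same quantity when all vertical weights are replaced by $0$, and $F_V(m,n)$ the same quantity when all horizontal weights are replaced by $0$. Then there are deterministic functions $f,f_H,f_V:\mathbb R_{\ge 0}^2\to\mathbb R$ (the limit shapes) such that for all $x,y\ge 0$, almost surely, \[ \frac{F(\lfloor nx\rfloor,\lfloor ny\rfloor)}{n}\to f(x,y),\qquad \frac{F_H(\lfloor nx\rfloor,\lfloor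 ny\rfloor)}{n}\to f_H(x,y),\qquad \frac{F_V(\lfloor nx\rfloor,\lfloor ny\rfloor)}{n}\to f_V(x,y) \] as $n\to\infty$, and for all $x,y\ge 0$ \[ f(x,y)=\max\bigl(f_H(x,y),f_V(x,y)\bigr). \] Moreover $f(x,y)=f_H(x,y)$ if $px\ge(1-p)y$ (for $p>0$: if $x\ge\frac{1-p}{p}y$), and $f(x,y)=f_V(x,y)$ otherwise. -/

import Mathlib

open MeasureTheory ProbabilityTheory Filter
open scoped Topology

/-- Up-right lattice paths in `ℤ_{≥0}²` from `(a, b)` to `(m, n)`: finite sequences of adjacent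
vertices in which every step goes one unit to the right or one unit up. -/
inductive UpRightPath (a b : ℕ) : ℕ → ℕ → Type
  | nil : UpRightPath a b a b
  | right {i j : ℕ} (π : UpRightPath a b i j) : UpRightPath a b (i + 1) j
  | up {i j : ℕ} (π : UpRightPath a b i j) : UpRightPath a b i (j + 1)

namespace UpRightPath

/-- The weight of a path: the sum of the weights of the edges it traverses. The horizontal edge
`(i - 1, j) → (i, j)` has weight `h i j`, the vertical edge `(i, j - 1) → (i, j)` has weight
`v i j`. -/
def weight (h v : ℕ → ℕ → ℝ) {a b : ℕ} : {m n : ℕ} → UpRightPath a b m n → ℝ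
  | _, _, nil => 0
  | _, _, right (i := i) (j := j) π => π.weight h v + h (i + 1) j
  | _, _, up (i := i) (j := j) π => π.weight h v + v i (j + 1)

/-- The steps of a path, last step first (`true` for right, `false` for up). -/
def steps {a b : ℕ} : {m n : ℕ} → UpRightPath a b m n → List Bool
  | _, _, nil => []
  | _, _, right π => true :: π.steps
  | _, _, up π => false :: π.steps

end UpRightPath

/-- The first-passage value from `(a, b)` to `(m, n)`: the minimum of the weights of the up-right
paths from `(a, b)` to `(m, n)`. For `a ≤ m` and `b ≤ n` the infimum is attained, see
`exists_weight_eq_firstPassage`. -/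
noncomputable def firstPassage (h v : ℕ → ℕ → ℝ) (a b m n : ℕ) : ℝ :=
  ⨅ π : UpRightPath a b m n, π.weight h v

namespace UpRightPath

theorem steps_length {a b : ℕ} : ∀ {m n : ℕ} (π : UpRightPath a b m n),
    π.steps.length + (a + b) = m + n
  | _, _, nil => by simp [steps]
  | _, _, right π => by have := steps_length π; simp [steps]; omega
  | _, _, up π => by have := steps_length π; simp [steps]; omega

theorem steps_injective {a b m n : ℕ} :
    Function.Injective (steps : UpRightPath a b m n → List Bool) := by
  have key : ∀ {m n : ℕ} (π : UpRightPath a b m n) {m' n' : ℕ} (π' : UpRightPath a b m' n'),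
      m = m' → n = n' → π.steps = π'.steps → HEq π π' := by
    intro m n π
    induction π with
    | nil =>
      intro m' n' π' hm hn hs
      cases π' <;> simp_all [steps]
    | right π ih =>
      intro m' n' π' hm hn hs
      cases π' with
      | nil => simp [steps] at hs
      | up _ => simp [steps] at hs
      | right π' =>
        obtain rfl : _ = _ := Nat.succ_injective hm
        subst hn
        have := ih π' rfl rfl (by simpa [steps] using hs)
        rw [eq_of_heq this]
    | up π ih =>
      intro m' n' π' hm hn hs
      cases π' with
      | nil => simp [steps] at hs
      | right _ => simp [steps] at hs
      | up π' =>
        obtain rfl : _ = _ := Nat.succ_injective hn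
        subst hm
        have := ih π' rfl rfl (by simpa [steps] using hs)
        rw [eq_of_heq this]
  intro π π' hs
  exact eq_of_heq (key π π' rfl rfl hs)

instance {a b m n : ℕ} : Finite (UpRightPath a b m n) := by
  have hf : Finite {l : List Bool | l.length = m + n - (a + b)} :=
    List.finite_length_eq Bool _
  refine Finite.of_injective
    (fun π : UpRightPath a b m n =>
      (⟨π.steps, ?_⟩ : {l : List Bool | l.length = m + n - (a + b)})) ?_
  · have := steps_length π
    simp only [Set.mem_ofPred_eq]
    omega
  · intro π π' hs
    exact steps_injective (by simpa using hs)

theorem nonempty {a b m n : ℕ} (ham : a ≤ m) (hbn : b ≤ n) :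
    Nonempty (UpRightPath a b m n) := by
  induction m, ham using Nat.le_induction with
  | base =>
    induction n, hbn using Nat.le_induction with
    | base => exact ⟨nil⟩
    | succ n _ ih => exact ih.map up
  | succ m _ ih => exact ih.map right

end UpRightPath

theorem exists_weight_eq_firstPassage (h v : ℕ → ℕ → ℝ) {a b m n : ℕ} (ham : a ≤ m)
    (hbn : b ≤ n) : ∃ π : UpRightPath a b m n, π.weight h v = firstPassage h v a b m n :=
  haveI := UpRightPath.nonempty ham hbn
  exists_eq_ciInf_of_finite

section Model

variable {Ω : Type*}

/-- The weight `B_{ij} ξ_{ij}` of the horizontal edge `(i - 1, j) → (i, j)`. -/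
def horizontalWeight (B ξ : ℕ → ℕ → Ω → ℝ) (ω : Ω) (i j : ℕ) : ℝ :=
  B i j ω * ξ i j ω

/-- The weight `(1 - B_{ij}) η_{ij}` of the vertical edge `(i, j - 1) → (i, j)`. -/
def verticalWeight (B η : ℕ → ℕ → Ω → ℝ) (ω : Ω) (i j : ℕ) : ℝ :=
  (1 - B i j ω) * η i j ω

/-- `F(m, n)`: first-passage value from the origin in the generalized Seppäläinen–Johansson
model. -/
noncomputable def passage (B ξ η : ℕ → ℕ → Ω → ℝ) (ω : Ω) (m n : ℕ) : ℝ :=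
  firstPassage (horizontalWeight B ξ ω) (verticalWeight B η ω) 0 0 m n

/-- `F_H(m, n)`: all weights on vertical edges are changed to `0`. -/
noncomputable def passageH (B ξ : ℕ → ℕ → Ω → ℝ) (ω : Ω) (m n : ℕ) : ℝ :=
  firstPassage (horizontalWeight B ξ ω) (fun _ _ => 0) 0 0 m n

/-- `F_V(m, n)`: all weights on horizontal edges are changed to `0`. -/
noncomputable def passageV (B η : ℕ → ℕ → Ω → ℝ) (ω : Ω) (m n : ℕ) : ℝ :=
  firstPassage (fun _ _ => 0) (verticalWeight B η ω) 0 0 m n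

/-- The deterministic function `f` on the closed quadrant is the limit shape of the random
function `F`: for all `x, y ≥ 0`, almost surely `F(⌊nx⌋, ⌊ny⌋) / n → f(x, y)`. -/
def IsLimitShape [MeasurableSpace Ω] (μ : Measure Ω) (F : Ω → ℕ → ℕ → ℝ) (f : ℝ → ℝ → ℝ) :
    Prop :=
  ∀ x y : ℝ, 0 ≤ x → 0 ≤ y → ∀ᵐ ω ∂μ,
    Tendsto (fun n : ℕ => F ω ⌊(n : ℝ) * x⌋₊ ⌊(n : ℝ) * y⌋₊ / (n : ℝ)) atTop (𝓝 (f x y))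

/-- All the random variables `B_{ij}`, `ξ_{ij}`, `η_{ij}` as one family. -/
def jointFamily (B ξ η : ℕ → ℕ → Ω → ℝ) : (ℕ × ℕ) ⊕ (ℕ × ℕ) ⊕ (ℕ × ℕ) → Ω → ℝ
  | .inl k => B k.1 k.2
  | .inr (.inl k) => ξ k.1 k.2
  | .inr (.inr k) => η k.1 k.2

end Model

/-! At every vertex one of the two incoming edges is free: the vertical one where `B = 1`, the
horizontal one where `B = 0`. Hence from every vertex a backward path of weight zero leads to a
coordinate axis. Dropping weights gives `F_H ≤ F` and `F_V ≤ F`, so it suffices to show `F ≤ F_H +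
o(n)` when `(1 - p) * y ≤ p * x`; transposing the lattice and replacing `B` by `1 - B` gives the
other sector, and the formula with the maximum follows.

The upper bound rests on a deterministic splicing (`firstPassage_le_weight_add_vertical`). Take a
path that is cheap for the horizontal weights alone. Walk back from a vertex on or above it along
free edges; whenever the walk would cross the path at a horizontal step, take that step instead. The
walk pays each horizontal edge of the path at most once and none of its vertical edges, and it
reaches the vertical axis at a height controlled by the exit heights of free backward paths. Only
the weights of the axis below that height are left to pay. To keep this height small, the path is
assembled from optimal paths of consecutive blocks of size of order `N` in direction `(x, y)`
(`firstPassage_le_sum_blocks`).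

The free backward path steps down with probability `p` and left with probability `1 - p`, so in this
sector its exit height is sublinear. An exponential moment bound and Borel–Cantelli
(`ae_eventually_exitHeight_le`) give at most `s` units of height per block, with `s` independent of
`N`. The axis cost per unit length is therefore of order `s / N` and vanishes as `N` grows; this
includes the critical direction. The cost of the blocks obeys the strong law, and its mean per unit
length approaches `f_H`.

Existence of `f_H` comes from a subadditive ergodic theorem (`ae_tendsto_of_subadditive`) on the
product space of weights, first in integer directions and then in all directions by monotonicity of
`F_H` in each coordinate. -/

/-! ### Deterministic facts about first-passage values -/

section FirstPassage

variable {h v : ℕ → ℕ → ℝ} {a b : ℕ}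

theorem UpRightPath.le_end {m n : ℕ} (π : UpRightPath a b m n) : a ≤ m ∧ b ≤ n := by
  induction π with
  | nil => exact ⟨le_rfl, le_rfl⟩
  | right π ih => exact ⟨by omega, ih.2⟩
  | up π ih => exact ⟨ih.1, by omega⟩

theorem firstPassage_le_weight {m n : ℕ} (π : UpRightPath a b m n) :
    firstPassage h v a b m n ≤ π.weight h v :=
  ciInf_le (Set.finite_range _).bddBelow π

theorem firstPassage_right_le {i j : ℕ} (hi : a ≤ i) (hj : b ≤ j) :
    firstPassage h v a b (i + 1) j ≤ firstPassage h v a b i j + h (i + 1) j := by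
  obtain ⟨π, hπ⟩ := exists_weight_eq_firstPassage h v hi hj
  exact (firstPassage_le_weight π.right).trans_eq (by rw [UpRightPath.weight, hπ])

theorem firstPassage_up_le {i j : ℕ} (hi : a ≤ i) (hj : b ≤ j) :
    firstPassage h v a b i (j + 1) ≤ firstPassage h v a b i j + v i (j + 1) := by
  obtain ⟨π, hπ⟩ := exists_weight_eq_firstPassage h v hi hj
  exact (firstPassage_le_weight π.up).trans_eq (by rw [UpRightPath.weight, hπ])

theorem firstPassage_self_le : firstPassage h v a b a b ≤ 0 :=
  firstPassage_le_weight (UpRightPath.nil)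

/-- A function that grows along each edge by at most the weight of the edge is bounded by the
weights of paths. -/
theorem le_weight_of_step {g : ℕ → ℕ → ℝ} (h0 : g a b ≤ 0)
    (hr : ∀ i j, a ≤ i → b ≤ j → g (i + 1) j ≤ g i j + h (i + 1) j)
    (hu : ∀ i j, a ≤ i → b ≤ j → g i (j + 1) ≤ g i j + v i (j + 1))
    {m n : ℕ} (π : UpRightPath a b m n) : g m n ≤ π.weight h v := by
  induction π with
  | nil => exact h0
  | @right i j π ih =>
    exact (hr i j π.le_end.1 π.le_end.2).trans (by rw [UpRightPath.weight]; gcongr)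
  | @up i j π ih =>
    exact (hu i j π.le_end.1 π.le_end.2).trans (by rw [UpRightPath.weight]; gcongr)

/-- The dual description of first passage: it is the largest function that is nonpositive at the
start and grows along each edge by at most the edge weight. The comparisons below (monotonicity,
triangle inequality, shift, transposition) come from a suitable choice of `g`, with no surgery on
paths. -/
theorem le_firstPassage_of_step {g : ℕ → ℕ → ℝ} (h0 : g a b ≤ 0)
    (hr : ∀ i j, a ≤ i → b ≤ j → g (i + 1) j ≤ g i j + h (i + 1) j)
    (hu : ∀ i j, a ≤ i → b ≤ j → g i (j + 1) ≤ g i j + v i (j + 1))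
    {m n : ℕ} (hm : a ≤ m) (hn : b ≤ n) : g m n ≤ firstPassage h v a b m n :=
  haveI := UpRightPath.nonempty hm hn
  le_ciInf fun π => le_weight_of_step h0 hr hu π

theorem firstPassage_nonneg (hh : ∀ i j, 0 ≤ h i j) (hv : ∀ i j, 0 ≤ v i j) {m n : ℕ} :
    0 ≤ firstPassage h v a b m n :=
  Real.iInf_nonneg fun π => le_weight_of_step (g := fun _ _ => 0) le_rfl
    (fun i j _ _ => by simpa using hh (i + 1) j) (fun i j _ _ => by simpa using hv i (j + 1)) π

theorem firstPassage_mono {h' v' : ℕ → ℕ → ℝ} (hh : ∀ i j, h i j ≤ h' i j)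
    (hv : ∀ i j, v i j ≤ v' i j) {m n : ℕ} (hm : a ≤ m) (hn : b ≤ n) :
    firstPassage h v a b m n ≤ firstPassage h' v' a b m n := by
  refine le_firstPassage_of_step (g := firstPassage h v a b) firstPassage_self_le ?_ ?_ hm hn
  · intro i j hi hj
    exact (firstPassage_right_le hi hj).trans (by have := hh (i + 1) j; gcongr)
  · intro i j hi hj
    exact (firstPassage_up_le hi hj).trans (by have := hv i (j + 1); gcongr)

theorem firstPassage_triangle {c d m n : ℕ} (hac : a ≤ c) (hbd : b ≤ d) (hcm : c ≤ m)
    (hdn : d ≤ n) :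
    firstPassage h v a b m n ≤ firstPassage h v a b c d + firstPassage h v c d m n := by
  have := le_firstPassage_of_step (h := h) (v := v)
    (g := fun i j => firstPassage h v a b i j - firstPassage h v a b c d) (sub_self _).le
    (fun i j hi hj => by
      linarith [firstPassage_right_le (h := h) (v := v) (hac.trans hi) (hbd.trans hj)])
    (fun i j hi hj => by
      linarith [firstPassage_up_le (h := h) (v := v) (hac.trans hi) (hbd.trans hj)]) hcm hdn
  linarith

theorem firstPassage_shift (s t : ℕ) {m n : ℕ} (hm : a ≤ m) (hn : b ≤ n) :
    firstPassage h v (s + a) (t + b) (s + m) (t + n) =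
      firstPassage (fun i j => h (s + i) (t + j)) (fun i j => v (s + i) (t + j)) a b m n := by
  apply le_antisymm
  · exact le_firstPassage_of_step
      (g := fun i j => firstPassage h v (s + a) (t + b) (s + i) (t + j)) firstPassage_self_le
      (fun i j hi hj => firstPassage_right_le (Nat.add_le_add_left hi s) (Nat.add_le_add_left hj t))
      (fun i j hi hj => firstPassage_up_le (Nat.add_le_add_left hi s) (Nat.add_le_add_left hj t))
      hm hn
  · have := le_firstPassage_of_step (a := s + a) (b := t + b) (h := h) (v := v)
      (m := s + m) (n := t + n)
      (g := fun i j => firstPassage (fun i j => h (s + i) (t + j)) (fun i j => v (s + i) (t + j))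
        a b (i - s) (j - t)) (by simpa using firstPassage_self_le)
      (fun i j hi hj => by
        obtain ⟨i, rfl⟩ := Nat.exists_eq_add_of_le (show s ≤ i by omega)
        obtain ⟨j, rfl⟩ := Nat.exists_eq_add_of_le (show t ≤ j by omega)
        simpa [add_assoc] using firstPassage_right_le (h := fun i j => h (s + i) (t + j))
          (v := fun i j => v (s + i) (t + j)) (show a ≤ i by omega) (show b ≤ j by omega))
      (fun i j hi hj => by
        obtain ⟨i, rfl⟩ := Nat.exists_eq_add_of_le (show s ≤ i by omega)
        obtain ⟨j, rfl⟩ := Nat.exists_eq_add_of_le (show t ≤ j by omega)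
        simpa [add_assoc] using firstPassage_up_le (h := fun i j => h (s + i) (t + j))
          (v := fun i j => v (s + i) (t + j)) (show a ≤ i by omega) (show b ≤ j by omega))
      (by omega) (by omega)
    simpa using this

theorem firstPassage_transpose_le {m n : ℕ} (hm : a ≤ m) (hn : b ≤ n) :
    firstPassage h v a b m n ≤
      firstPassage (fun i j => v j i) (fun i j => h j i) b a n m :=
  le_firstPassage_of_step (g := fun i j => firstPassage h v a b j i) firstPassage_self_le
    (fun _ _ hi hj => firstPassage_up_le hj hi) (fun _ _ hi hj => firstPassage_right_le hj hi) hn hm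

theorem firstPassage_transpose {m n : ℕ} (hm : a ≤ m) (hn : b ≤ n) :
    firstPassage (fun i j => v j i) (fun i j => h j i) b a n m = firstPassage h v a b m n :=
  le_antisymm (firstPassage_transpose_le hn hm) (firstPassage_transpose_le hm hn)

theorem firstPassage_zero_antitone {m n n' : ℕ} (hm : a ≤ m) (hn : b ≤ n) (hnn : n ≤ n') :
    firstPassage h (fun _ _ => 0) a b m n' ≤ firstPassage h (fun _ _ => 0) a b m n := by
  induction n', hnn using Nat.le_induction with
  | base => exact le_rfl
  | succ k hk ih =>
    exact (firstPassage_up_le hm (hn.trans hk)).trans (by simpa using ih)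

/-- A path to `(m', n)` visits column `m` at some height at most `n`. Cut it there and go up for
free; the discarded horizontal weights are nonnegative. -/
theorem firstPassage_zero_monotone (hh : ∀ i j, 0 ≤ h i j) {m m' n : ℕ} (hm : a ≤ m) (hn : b ≤ n)
    (hmm : m ≤ m') :
    firstPassage h (fun _ _ => 0) a b m n ≤ firstPassage h (fun _ _ => 0) a b m' n := by
  have key : ∀ {m' n : ℕ} (π : UpRightPath a b m' n) (m : ℕ), a ≤ m → m ≤ m' →
      firstPassage h (fun _ _ => 0) a b m n ≤ π.weight h (fun _ _ => 0) := by
    intro m' n π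
    induction π with
    | nil =>
      intro m h1 h2
      obtain rfl := le_antisymm h1 h2
      exact firstPassage_self_le
    | @right i j π ih =>
      intro m h1 h2
      rcases Nat.le_succ_iff.1 h2 with h2 | rfl
      · rw [UpRightPath.weight]
        linarith [ih m h1 h2, hh (i + 1) j]
      · exact firstPassage_le_weight π.right
    | @up i j π ih =>
      intro m h1 h2
      have := firstPassage_up_le (h := h) (v := fun _ _ => 0) h1 π.le_end.2
      rw [UpRightPath.weight]
      linarith [ih m h1 h2]
  have := UpRightPath.nonempty (hm.trans hmm) hn
  exact le_ciInf fun π => key π m hm hmm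

theorem firstPassage_congr_on_axis {v' : ℕ → ℕ → ℝ} {m : ℕ} (hm : a ≤ m) :
    firstPassage h v a b m b = firstPassage h v' a b m b := by
  have key : ∀ v v' : ℕ → ℕ → ℝ, firstPassage h v a b m b ≤ firstPassage h v' a b m b := by
    intro v v'
    have := UpRightPath.nonempty hm (le_refl b)
    refine le_ciInf fun π => ?_
    have : ∀ {m n : ℕ} (π : UpRightPath a b m n), n = b →
        firstPassage h v a b m b ≤ π.weight h v' := by
      intro m n π
      induction π with
      | nil => intro _; exact firstPassage_self_le
      | @right i j π ih =>
        rintro rfl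
        refine (firstPassage_right_le π.le_end.1 le_rfl).trans ?_
        rw [UpRightPath.weight]
        linarith [ih rfl]
      | up π ih => intro hb; have := π.le_end; omega
    exact this π rfl
  exact le_antisymm (key _ _) (key _ _)

theorem firstPassage_vertical_le (k : ℕ) :
    firstPassage h v 0 0 0 k ≤ ∑ l ∈ Finset.range k, v 0 (l + 1) := by
  induction k with
  | zero => simpa using firstPassage_self_le
  | succ k ih =>
    rw [Finset.sum_range_succ]
    exact (firstPassage_up_le le_rfl (Nat.zero_le k)).trans (by gcongr)

theorem firstPassage_horizontal_le (k : ℕ) :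
    firstPassage h v 0 0 k 0 ≤ ∑ l ∈ Finset.range k, h (l + 1) 0 := by
  induction k with
  | zero => simpa using firstPassage_self_le
  | succ k ih =>
    rw [Finset.sum_range_succ]
    exact (firstPassage_right_le (Nat.zero_le k) le_rfl).trans (by gcongr)

end FirstPassage

/-! ### Backward paths of weight zero -/

section ExitHeight

/-- From `(i, j)` step down where `B = 1` and to the left elsewhere, until a coordinate axis is
reached. This is the height at which the vertical axis is reached, and `0` if the horizontal axis
is reached first. -/
noncomputable def exitHeight (B : ℕ → ℕ → ℝ) : ℕ → ℕ → ℕ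
  | 0, j => j
  | _ + 1, 0 => 0
  | i + 1, j + 1 => if B (i + 1) (j + 1) = 1 then exitHeight B (i + 1) j else exitHeight B i (j + 1)

variable {B : ℕ → ℕ → ℝ}

@[simp] theorem exitHeight_zero_left (j : ℕ) : exitHeight B 0 j = j := by simp [exitHeight]

@[simp] theorem exitHeight_zero_right (i : ℕ) : exitHeight B i 0 = 0 := by
  cases i <;> simp [exitHeight]

theorem exitHeight_succ_succ (i j : ℕ) : exitHeight B (i + 1) (j + 1) =
    if B (i + 1) (j + 1) = 1 then exitHeight B (i + 1) j else exitHeight B i (j + 1) := by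
  rw [exitHeight]

/-- Free backward paths do not cross, so the exit height increases with the starting height and
decreases as the start moves right. The two inequalities are proved together since each induction
step for one uses the other. -/
theorem exitHeight_step (i j : ℕ) :
    exitHeight B i j ≤ exitHeight B i (j + 1) ∧ exitHeight B (i + 1) j ≤ exitHeight B i j := by
  induction i generalizing j with
  | zero =>
    induction j with
    | zero => simp
    | succ j ih =>
      refine ⟨by simp, ?_⟩
      rw [exitHeight_succ_succ]
      split_ifs
      · exact ih.2.trans ih.1
      · exact le_rfl
  | succ i ihi =>
    have up : ∀ j, exitHeight B (i + 1) j ≤ exitHeight B (i + 1) (j + 1) := by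
      intro j
      rw [exitHeight_succ_succ]
      split_ifs
      · exact le_rfl
      · exact (ihi j).2.trans (ihi j).1
    refine ⟨up j, ?_⟩
    induction j with
    | zero => simp
    | succ j ihj =>
      rw [exitHeight_succ_succ]
      split_ifs
      · exact ihj.trans (up j)
      · exact le_rfl

theorem exitHeight_mono {i i' j j' : ℕ} (hi : i' ≤ i) (hj : j ≤ j') :
    exitHeight B i j ≤ exitHeight B i' j' :=
  (monotone_nat_of_le_succ (fun j => (exitHeight_step (B := B) i j).1) hj).trans
    (antitone_nat_of_succ_le (f := fun i => exitHeight B i j')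
      (fun i => (exitHeight_step (B := B) i j').2) hi)

theorem exitHeight_le (i j : ℕ) : exitHeight B i j ≤ j := by
  simpa using exitHeight_mono (B := B) (Nat.zero_le i) (le_refl j)

variable {h v : ℕ → ℕ → ℝ}

/-- The splicing argument. If the free backward walk from `(i, l)` never meets `π`, it keeps the
exit height of `(i, l)`. Once it has met `π` it continues from a vertex with column at least `a` and
height at most `n`, whose exit height is at most that of `(a, n)`, hence at most `s`. This is the
reason for `max s _`. The hypothesis `hc` takes over in column `a`. -/
theorem firstPassage_le_weight_add_vertical (hh : ∀ i j, 0 ≤ h i j) (hv : ∀ i j, 0 ≤ v i j)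
    (hv0 : ∀ i j, B i j = 1 → v i j = 0) (hh0 : ∀ i j, B i j ≠ 1 → h i j = 0)
    {a b s : ℕ} {c : ℝ}
    (hc : ∀ l, b ≤ l → firstPassage h v 0 0 a l ≤
      c + ∑ k ∈ Finset.range (max s (exitHeight B a l)), v 0 (k + 1))
    {m n : ℕ} (π : UpRightPath a b m n) (hs : exitHeight B a n ≤ s) {i l : ℕ} (hai : a ≤ i)
    (him : i ≤ m) (hl : n ≤ l) :
    firstPassage h v 0 0 i l ≤ c + π.weight h (fun _ _ => 0) +
      ∑ k ∈ Finset.range (max s (exitHeight B i l)), v 0 (k + 1) := by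
  induction π generalizing i l with
  | nil =>
    obtain rfl := le_antisymm hai him
    simpa [UpRightPath.weight] using hc l hl
  | @up m n π ih =>
    simpa [UpRightPath.weight] using
      ih ((exitHeight_mono le_rfl (Nat.le_succ n)).trans hs) hai him (by omega)
  | @right m n π ih =>
    have hW : (π.right).weight h (fun _ _ => 0) = π.weight h (fun _ _ => 0) + h (m + 1) n := rfl
    rcases Nat.le_succ_iff.1 him with him | rfl
    · linarith [ih hs hai him hl, hh (m + 1) n]
    · have ham := π.le_end.1
      induction l, hl using Nat.le_induction with
      -- The walk is on `π` at the end of a horizontal step: the step is paid, and the maximum drops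
      -- to `s` on its left side.
      | base =>
        have h1 := ih hs ham le_rfl le_rfl
        rw [max_eq_left ((exitHeight_mono ham le_rfl).trans hs)] at h1
        have h2 : ∑ k ∈ Finset.range s, v 0 (k + 1) ≤
            ∑ k ∈ Finset.range (max s (exitHeight B (m + 1) n)), v 0 (k + 1) :=
          Finset.sum_le_sum_of_subset_of_nonneg
            (Finset.range_subset_range.2 (le_max_left _ _)) fun k _ _ => hv 0 (k + 1)
        linarith [firstPassage_right_le (h := h) (v := v) (Nat.zero_le m) (Nat.zero_le n)]
      | succ l hl ihl =>
        -- Strictly above `π` the walk takes the free edge, and the exit height is unchanged along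
        -- it.
        rw [exitHeight_succ_succ]
        split_ifs with hB
        · have := firstPassage_up_le (h := h) (v := v) (Nat.zero_le (m + 1)) (Nat.zero_le l)
          rw [hv0 _ _ hB] at this
          linarith
        · have := firstPassage_right_le (h := h) (v := v) (Nat.zero_le m) (Nat.zero_le (l + 1))
          rw [hh0 _ _ hB] at this
          linarith [ih hs ham le_rfl (hl.trans (Nat.le_succ l)), hh (m + 1) n]

/-- The splicing is iterated over blocks; each block passes its bound on its left column to the
previous one. Among the vertices of block `t` the upper left corner `(t * a, (t + 1) * b)` has the
largest exit height, so it is the only one to control. -/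
theorem firstPassage_le_sum_blocks (hh : ∀ i j, 0 ≤ h i j) (hv : ∀ i j, 0 ≤ v i j)
    (hv0 : ∀ i j, B i j = 1 → v i j = 0) (hh0 : ∀ i j, B i j ≠ 1 → h i j = 0)
    {a b s T : ℕ} (hs : ∀ t < T, exitHeight B (t * a) ((t + 1) * b) ≤ s) {i l : ℕ}
    (hi : i ≤ T * a) (hl : T * b ≤ l) :
    firstPassage h v 0 0 i l ≤
      ∑ t ∈ Finset.range T,
        firstPassage h (fun _ _ => 0) (t * a) (t * b) ((t + 1) * a) ((t + 1) * b) +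
      ∑ k ∈ Finset.range (max s (exitHeight B i l)), v 0 (k + 1) := by
  induction T generalizing i l with
  | zero =>
    obtain rfl : i = 0 := by simpa using hi
    simp only [Finset.range_zero, Finset.sum_empty, exitHeight_zero_left, zero_add]
    exact (firstPassage_vertical_le l).trans (Finset.sum_le_sum_of_subset_of_nonneg
      (Finset.range_subset_range.2 (le_max_right _ _)) fun k _ _ => hv 0 (k + 1))
  | succ T ih =>
    have hs' : ∀ t < T, exitHeight B (t * a) ((t + 1) * b) ≤ s := fun t ht => hs t (by omega)
    have hab : T * a ≤ (T + 1) * a ∧ T * b ≤ (T + 1) * b :=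
      ⟨Nat.mul_le_mul_right _ (Nat.le_succ T), Nat.mul_le_mul_right _ (Nat.le_succ T)⟩
    obtain ⟨π, hπ⟩ := exists_weight_eq_firstPassage h (fun _ _ => 0) hab.1 hab.2
    rw [Finset.sum_range_succ]
    rcases le_total i (T * a) with hiT | hiT
    · have := firstPassage_nonneg (h := h) (v := fun _ _ => 0) (a := T * a) (b := T * b)
        (m := (T + 1) * a) (n := (T + 1) * b) hh (fun _ _ => le_rfl)
      linarith [ih hs' hiT (hab.2.trans hl)]
    · rw [← hπ]
      exact firstPassage_le_weight_add_vertical hh hv hv0 hh0 (fun l hl => ih hs' le_rfl hl) π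
        (hs T (Nat.lt_succ_self T)) hiT hi hl

end ExitHeight

/-! ### A subadditive ergodic theorem -/

section Subadditive

theorem tendsto_natDiv_div_self {N : ℕ} (hN : N ≠ 0) :
    Tendsto (fun n : ℕ => ((n / N : ℕ) : ℝ) / n) atTop (𝓝 (1 / N)) := by
  have h := (tendsto_nat_floor_mul_div_atTop (R := ℝ) (a := 1 / N) (by positivity)).comp
    tendsto_natCast_atTop_atTop
  refine h.congr fun n => ?_
  simp only [Function.comp_apply]
  rw [← Nat.floor_div_eq_div (K := ℝ) n N, one_div_mul_eq_div]

theorem tendsto_natDiv_atTop {N : ℕ} (hN : N ≠ 0) : Tendsto (fun n : ℕ => n / N) atTop atTop :=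
  Nat.tendsto_div_const_atTop hN

/-- If `u k / k → c` then `u (n / N) / n → c / N`. -/
theorem tendsto_comp_natDiv {u : ℕ → ℝ} {c : ℝ} (hu : Tendsto (fun k : ℕ => u k / k) atTop (𝓝 c))
    {N : ℕ} (hN : N ≠ 0) : Tendsto (fun n : ℕ => u (n / N) / n) atTop (𝓝 (c / N)) := by
  have h := (hu.comp (tendsto_natDiv_atTop hN)).mul (tendsto_natDiv_div_self hN)
  rw [mul_one_div] at h
  refine h.congr' ?_
  filter_upwards [eventually_ge_atTop N] with n hn
  have h1 : ((n / N : ℕ) : ℝ) ≠ 0 := by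
    have := Nat.div_pos hn (Nat.pos_of_ne_zero hN)
    positivity
  simp only [Function.comp_apply]
  field_simp

variable {Ω : Type*} {T : Ω → Ω} {X : ℕ → Ω → ℝ}

theorem subadditive_le_sum (h0 : ∀ ω, X 0 ω = 0)
    (hsub : ∀ m n ω, X (m + n) ω ≤ X m ω + X n (T^[m] ω)) (N k : ℕ) (ω : Ω) :
    X (k * N) ω ≤ ∑ t ∈ Finset.range k, X N (T^[t * N] ω) := by
  induction k with
  | zero => simp [h0]
  | succ k ih =>
    rw [Finset.sum_range_succ, Nat.succ_mul]
    exact (hsub _ _ _).trans (by gcongr)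

theorem subadditive_le_sum_one (h0 : ∀ ω, X 0 ω = 0)
    (hsub : ∀ m n ω, X (m + n) ω ≤ X m ω + X n (T^[m] ω)) (n : ℕ) (ω : Ω) :
    X n ω ≤ ∑ t ∈ Finset.range n, X 1 (T^[t] ω) := by
  simpa using subadditive_le_sum h0 hsub 1 n ω

theorem eventually_subadditive_div_le (h0 : ∀ ω, X 0 ω = 0)
    (hsub : ∀ m n ω, X (m + n) ω ≤ X m ω + X n (T^[m] ω)) {N : ℕ} (hN : N ≠ 0) {c e : ℝ} {ω : Ω}
    (hc : Tendsto (fun k : ℕ => (∑ t ∈ Finset.range k, X 1 (T^[t] ω)) / k) atTop (𝓝 c))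
    (he : Tendsto (fun k : ℕ => (∑ t ∈ Finset.range k, X N (T^[t * N] ω)) / k) atTop (𝓝 e))
    {δ : ℝ} (hδ : e / N < δ) : ∀ᶠ n : ℕ in atTop, X n ω / n < δ := by
  set S : ℕ → ℝ := fun n => ∑ t ∈ Finset.range n, X 1 (T^[t] ω) with hS
  set U : ℕ → ℝ := fun k => ∑ t ∈ Finset.range k, X N (T^[t * N] ω) with hU
  have hSN : Tendsto (fun k : ℕ => S (k * N) / k) atTop (𝓝 (c * N)) := by
    have h1 : Tendsto (fun k : ℕ => k * N) atTop atTop :=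
      tendsto_id.atTop_mul_const' (Nat.pos_of_ne_zero hN)
    refine ((hc.comp h1).mul_const (N : ℝ)).congr fun k => ?_
    simp only [Function.comp_apply, Nat.cast_mul]
    have : (N : ℝ) ≠ 0 := by exact_mod_cast hN
    rcases eq_or_ne k 0 with rfl | hk
    · simp
    · field_simp
      simp only [hS]
  -- The incomplete last block costs at most `S n - S (n / N * N)`, which is `o(n)` because `S n /
  -- n` converges.
  have hlim : Tendsto (fun n : ℕ => U (n / N) / n + (S n / n - S (n / N * N) / n)) atTop
      (𝓝 (e / N + (c - c * N / N))) :=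
    (tendsto_comp_natDiv he hN).add (hc.sub (tendsto_comp_natDiv (u := fun k => S (k * N)) hSN hN))
  have hN' : (N : ℝ) ≠ 0 := by exact_mod_cast hN
  rw [mul_div_cancel_right₀ _ hN', sub_self, add_zero] at hlim
  filter_upwards [hlim.eventually_lt_const hδ] with n hn
  refine lt_of_le_of_lt ?_ hn
  have hle : n / N * N ≤ n := Nat.div_mul_le_self n N
  have h1 : X n ω ≤ U (n / N) + (S n - S (n / N * N)) := by
    have h2 := hsub (n / N * N) (n - n / N * N) ω
    rw [Nat.add_sub_cancel' hle] at h2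
    have h3 := subadditive_le_sum_one h0 hsub (n - n / N * N) (T^[n / N * N] ω)
    have h4 : S n = S (n / N * N) +
        ∑ t ∈ Finset.range (n - n / N * N), X 1 (T^[t] (T^[n / N * N] ω)) := by
      simp only [hS]
      conv_lhs => rw [← Nat.add_sub_cancel' hle, Finset.sum_range_add]
      congr 1
      refine Finset.sum_congr rfl fun t _ => ?_
      rw [add_comm, Function.iterate_add_apply]
    linarith [subadditive_le_sum h0 hsub N (n / N) ω]
  rw [← sub_div, ← add_div]
  gcongr

/-- A path of the orbit is cut into stretches on which `X` is at most `θ` times the length, single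
steps that start in `A`, and a last stretch of length at most `L`. -/
theorem subadditive_le_of_stopping (h0 : ∀ ω, X 0 ω = 0) (hnn : ∀ n ω, 0 ≤ X n ω)
    (hsub : ∀ m n ω, X (m + n) ω ≤ X m ω + X n (T^[m] ω)) {θ : ℝ} (hθ : 0 ≤ θ) {A : Set Ω} {L : ℕ}
    (n : ℕ) (ω : Ω)
    (hcut : ∀ k, T^[k] ω ∉ A → ∃ m, 1 ≤ m ∧ m ≤ L ∧ X m (T^[k] ω) ≤ m * θ) :
    X n ω ≤ n * θ + ∑ k ∈ Finset.range n, A.indicator (X 1) (T^[k] ω) +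
      ∑ k ∈ Finset.range n, if n ≤ k + L then X 1 (T^[k] ω) else 0 := by
  have hind : ∀ ω, 0 ≤ A.indicator (X 1) ω := fun ω => Set.indicator_nonneg (fun _ _ => hnn 1 _) _
  induction n using Nat.strong_induction_on generalizing ω with
  | _ n ih =>
  rcases le_or_gt n L with hnL | hnL
  · have h1 := subadditive_le_sum_one h0 hsub n ω
    have h2 : ∑ k ∈ Finset.range n, (if n ≤ k + L then X 1 (T^[k] ω) else 0) =
        ∑ t ∈ Finset.range n, X 1 (T^[t] ω) :=
      Finset.sum_congr rfl fun k _ => if_pos (by omega)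
    rw [h2]
    have : 0 ≤ ∑ k ∈ Finset.range n, A.indicator (X 1) (T^[k] ω) :=
      Finset.sum_nonneg fun k _ => hind _
    have : 0 ≤ (n : ℝ) * θ := by positivity
    linarith
  -- It suffices to find one admissible initial stretch: the rest of the orbit is handled by
  -- induction, and the tail condition `n ≤ k + L` is invariant when `n` and `k` are shifted
  -- together.
  · have key : ∀ m, 1 ≤ m → m ≤ n →
        X m ω ≤ m * θ + ∑ k ∈ Finset.range m, A.indicator (X 1) (T^[k] ω) →
        X n ω ≤ n * θ + ∑ k ∈ Finset.range n, A.indicator (X 1) (T^[k] ω) +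
          ∑ k ∈ Finset.range n, if n ≤ k + L then X 1 (T^[k] ω) else 0 := by
      intro m hm1 hmn hm
      obtain ⟨r, rfl⟩ := Nat.exists_eq_add_of_le hmn
      have h1 := ih r (by omega) (T^[m] ω) (fun k hk => by
        rw [← Function.iterate_add_apply] at hk ⊢
        exact hcut _ hk)
      have e1 : ∀ k, T^[k] (T^[m] ω) = T^[m + k] ω := fun k => by
        rw [add_comm, Function.iterate_add_apply]
      simp only [e1] at h1
      rw [Finset.sum_range_add, Finset.sum_range_add]
      have h2 : ∑ k ∈ Finset.range r, (if r ≤ k + L then X 1 (T^[m + k] ω) else 0) =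
          ∑ k ∈ Finset.range r, if m + r ≤ m + k + L then X 1 (T^[m + k] ω) else 0 :=
        Finset.sum_congr rfl fun k _ => by congr 1; simp [add_assoc]
      have h3 : 0 ≤ ∑ k ∈ Finset.range m, if m + r ≤ k + L then X 1 (T^[k] ω) else 0 :=
        Finset.sum_nonneg fun k _ => by split_ifs; exacts [hnn _ _, le_rfl]
      rw [h2] at h1
      push_cast
      linarith [hsub m r ω]
    by_cases hA : ω ∈ A
    · refine key 1 le_rfl (by omega) ?_
      simp [hA, hθ]
    · obtain ⟨m, hm1, hmL, hm⟩ := hcut 0 hA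
      refine key m hm1 (by omega) (hm.trans ?_)
      have : 0 ≤ ∑ k ∈ Finset.range m, A.indicator (X 1) (T^[k] ω) :=
        Finset.sum_nonneg fun k _ => hind _
      linarith

variable [MeasurableSpace Ω] {μ : Measure Ω}

theorem integrable_of_subadditive (hT : MeasurePreserving T μ μ)
    (hX : ∀ n, Measurable (X n)) (h0 : ∀ ω, X 0 ω = 0) (hnn : ∀ n ω, 0 ≤ X n ω)
    (hsub : ∀ m n ω, X (m + n) ω ≤ X m ω + X n (T^[m] ω)) (hint : Integrable (X 1) μ) (n : ℕ) :
    Integrable (X n) μ := by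
  refine Integrable.mono' (g := fun ω => ∑ t ∈ Finset.range n, X 1 (T^[t] ω))
    (integrable_finsetSum _ fun t _ => (hT.iterate t).integrable_comp_of_integrable hint)
    (hX n).aestronglyMeasurable (ae_of_all _ fun ω => ?_)
  rw [Real.norm_of_nonneg (hnn n ω)]
  exact subadditive_le_sum_one h0 hsub n ω

/-- Integrate the decomposition of orbits, with `θ` constant along almost every orbit. The last
stretch contributes at most `L * ∫ X 1`, which disappears after division by `n`; then `L → ∞`
removes the bad set by dominated convergence. -/
theorem le_integral_of_stopping [IsProbabilityMeasure μ] (hT : MeasurePreserving T μ μ)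
    (hX : ∀ n, Measurable (X n)) (h0 : ∀ ω, X 0 ω = 0) (hnn : ∀ n ω, 0 ≤ X n ω)
    (hsub : ∀ m n ω, X (m + n) ω ≤ X m ω + X n (T^[m] ω)) (hint : Integrable (X 1) μ) {γ : ℝ}
    (hγ : ∀ n : ℕ, n * γ ≤ ∫ ω, X n ω ∂μ) {θ : Ω → ℝ} (hθm : Measurable θ) (hθ : Integrable θ μ)
    (hθ0 : ∀ ω, 0 ≤ θ ω) (hinv : ∀ᵐ ω ∂μ, θ (T ω) = θ ω)
    (hex : ∀ᵐ ω ∂μ, ∃ m : ℕ, 1 ≤ m ∧ X m ω ≤ m * θ ω) : γ ≤ ∫ ω, θ ω ∂μ := by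
  -- The bad set: no stretch of length at most `L` starting here has average at most `θ`.
  set A : ℕ → Set Ω := fun L => {ω | ∀ m : ℕ, 1 ≤ m → m ≤ L → m * θ ω < X m ω} with hA
  have hAm : ∀ L, MeasurableSet (A L) := fun L => by
    simp only [hA, Set.ofPred_forall]
    refine MeasurableSet.iInter fun m => MeasurableSet.iInter fun _ => MeasurableSet.iInter fun _ =>
      measurableSet_lt (hθm.const_mul _) (hX m)
  have hinv' : ∀ᵐ ω ∂μ, ∀ k, θ (T^[k] ω) = θ ω := by
    have h1 : ∀ᵐ ω ∂μ, ∀ k, θ (T (T^[k] ω)) = θ (T^[k] ω) :=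
      ae_all_iff.2 fun k => (hT.iterate k).quasiMeasurePreserving.ae hinv
    filter_upwards [h1] with ω hω k
    induction k with
    | zero => rfl
    | succ k ih => rw [Function.iterate_succ_apply', hω k, ih]
  have hIA : ∀ L, Integrable ((A L).indicator (X 1)) μ := fun L => hint.indicator (hAm L)
  have hmul_le : ∀ L n : ℕ, n * γ ≤ n * ∫ ω, θ ω ∂μ + n * ∫ ω, (A L).indicator (X 1) ω ∂μ +
      L * ∫ ω, X 1 ω ∂μ := by
    intro L n
    have hi1 : ∀ k, Integrable (fun ω => (A L).indicator (X 1) (T^[k] ω)) μ := fun k =>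
      (hT.iterate k).integrable_comp_of_integrable (hIA L)
    have hi2 : ∀ k, Integrable (fun ω => X 1 (T^[k] ω)) μ := fun k =>
      (hT.iterate k).integrable_comp_of_integrable hint
    have hi3 : ∀ k, Integrable (fun ω => if n ≤ k + L then X 1 (T^[k] ω) else 0) μ := fun k => by
      split_ifs
      exacts [hi2 k, integrable_zero _ _ _]
    have e1 : ∀ k, ∫ ω, (A L).indicator (X 1) (T^[k] ω) ∂μ = ∫ ω, (A L).indicator (X 1) ω ∂μ :=
      fun k => by
        have := integral_map (μ := μ) (hT.iterate k).measurable.aemeasurable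
          (f := (A L).indicator (X 1))
          ((hX 1).indicator (hAm L)).aestronglyMeasurable
        rw [← this, (hT.iterate k).map_eq]
    have e2 : ∀ k, ∫ ω, X 1 (T^[k] ω) ∂μ = ∫ ω, X 1 ω ∂μ := fun k => by
      have := integral_map (μ := μ) (hT.iterate k).measurable.aemeasurable (f := X 1)
        (hX 1).aestronglyMeasurable
      rw [← this, (hT.iterate k).map_eq]
    refine (hγ n).trans ?_
    have hle : ∫ ω, X n ω ∂μ ≤ ∫ ω, (n * θ ω + ∑ k ∈ Finset.range n, (A L).indicator (X 1) (T^[k] ω) +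
      ∑ k ∈ Finset.range n, if n ≤ k + L then X 1 (T^[k] ω) else 0) ∂μ := by
      refine integral_mono_ae (integrable_of_subadditive hT hX h0 hnn hsub hint n)
        (((hθ.const_mul _).add (integrable_finsetSum _ fun k _ => hi1 k)).add
          (integrable_finsetSum _ fun k _ => hi3 k)) ?_
      filter_upwards [hinv'] with ω hω
      refine subadditive_le_of_stopping h0 hnn hsub (hθ0 ω) n ω fun k hk => ?_
      simp only [hA, Set.mem_ofPred_eq, not_forall, not_lt] at hk
      obtain ⟨m, h1, h2, h3⟩ := hk
      exact ⟨m, h1, h2, by rwa [hω k] at h3⟩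
    refine hle.trans ?_
    have hi4 : Integrable (fun ω => n * θ ω +
        ∑ k ∈ Finset.range n, (A L).indicator (X 1) (T^[k] ω)) μ :=
      (hθ.const_mul _).add (integrable_finsetSum _ fun k _ => hi1 k)
    rw [integral_add hi4
        (integrable_finsetSum _ fun k _ => hi3 k),
      integral_add (hθ.const_mul _) (integrable_finsetSum _ fun k _ => hi1 k),
      integral_const_mul, integral_finsetSum _ fun k _ => hi1 k,
      integral_finsetSum _ fun k _ => hi3 k]
    simp only [e1, Finset.sum_const, Finset.card_range, nsmul_eq_mul]
    gcongr
    have e3 : ∀ k, ∫ ω, (if n ≤ k + L then X 1 (T^[k] ω) else 0) ∂μ =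
        if n ≤ k + L then ∫ ω, X 1 ω ∂μ else 0 := fun k => by
      split_ifs
      exacts [e2 k, integral_zero _ _]
    simp only [e3]
    rw [← Finset.sum_filter, Finset.sum_const, nsmul_eq_mul]
    have hcard : ((Finset.range n).filter fun k => n ≤ k + L).card ≤ L := by
      have : (Finset.range n).filter (fun k => n ≤ k + L) ⊆ Finset.Ico (n - L) n := by
        intro k hk
        simp only [Finset.mem_filter, Finset.mem_range, Finset.mem_Ico] at hk ⊢
        omega
      refine (Finset.card_le_card this).trans ?_
      simp only [Nat.card_Ico]
      omega
    have : 0 ≤ ∫ ω, X 1 ω ∂μ := integral_nonneg fun ω => hnn 1 ω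
    gcongr
  have hle_add : ∀ L : ℕ, γ ≤ ∫ ω, θ ω ∂μ + ∫ ω, (A L).indicator (X 1) ω ∂μ := by
    intro L
    have hlim : Tendsto (fun n : ℕ => ∫ ω, θ ω ∂μ + ∫ ω, (A L).indicator (X 1) ω ∂μ +
        (L * ∫ ω, X 1 ω ∂μ) / (n : ℝ)) atTop
        (𝓝 (∫ ω, θ ω ∂μ + ∫ ω, (A L).indicator (X 1) ω ∂μ + 0)) :=
      tendsto_const_nhds.add (tendsto_const_div_atTop_nhds_zero_nat _)
    rw [add_zero] at hlim
    refine ge_of_tendsto hlim ?_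
    filter_upwards [eventually_gt_atTop 0] with n hn
    have hn' : (0 : ℝ) < n := by exact_mod_cast hn
    have h1 := hmul_le L n
    have h2 : (∫ ω, θ ω ∂μ + ∫ ω, (A L).indicator (X 1) ω ∂μ + (L * ∫ ω, X 1 ω ∂μ) / (n : ℝ)) =
        (n * ∫ ω, θ ω ∂μ + n * ∫ ω, (A L).indicator (X 1) ω ∂μ + L * ∫ ω, X 1 ω ∂μ) / n := by
      field_simp
    rw [h2, le_div_iff₀ hn']
    linarith
  have hlim : Tendsto (fun L => ∫ ω, (A L).indicator (X 1) ω ∂μ) atTop (𝓝 (∫ _, (0 : ℝ) ∂μ)) := by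
    refine tendsto_integral_of_dominated_convergence (X 1)
      (fun L => ((hX 1).indicator (hAm L)).aestronglyMeasurable) hint
      (fun L => ae_of_all _ fun ω => ?_) ?_
    · rw [Real.norm_of_nonneg (Set.indicator_nonneg (fun _ _ => hnn 1 _) _)]
      exact Set.indicator_le_self' (fun _ _ => hnn 1 _) ω
    · filter_upwards [hex] with ω ⟨m, hm1, hm⟩
      refine tendsto_const_nhds.congr' ?_
      filter_upwards [eventually_ge_atTop m] with L hL
      rw [Set.indicator_of_notMem]
      intro hω
      exact absurd (hω m hm1 hL) (not_lt.2 hm)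
  have := ge_of_tendsto (hlim.const_add (∫ ω, θ ω ∂μ)) (Eventually.of_forall hle_add)
  simpa using this

/-- The bound on the limsup follows from the strong law for blocks of length `N`, assumed as
`hblock`. For the liminf, a set on which it lies below `α < γ` is invariant up to a null set; the
stopping inequality with `θ = α` on it and `θ = γ + ε` elsewhere forces measure zero. Ergodicity of
`T` is not needed. -/
theorem ae_tendsto_of_subadditive [IsProbabilityMeasure μ] (hT : MeasurePreserving T μ μ)
    (hX : ∀ n, Measurable (X n)) (h0 : ∀ ω, X 0 ω = 0) (hnn : ∀ n ω, 0 ≤ X n ω)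
    (hsub : ∀ m n ω, X (m + n) ω ≤ X m ω + X n (T^[m] ω)) (hint : Integrable (X 1) μ) {γ : ℝ}
    (hγ : ∀ n : ℕ, n * γ ≤ ∫ ω, X n ω ∂μ)
    (hlim : Tendsto (fun n : ℕ => (∫ ω, X n ω ∂μ) / n) atTop (𝓝 γ))
    (hblock : ∀ N, ∀ᵐ ω ∂μ, Tendsto
      (fun k : ℕ => (∑ t ∈ Finset.range k, X N (T^[t * N] ω)) / k) atTop (𝓝 (∫ ω, X N ω ∂μ))) :
    ∀ᵐ ω ∂μ, Tendsto (fun n : ℕ => X n ω / n) atTop (𝓝 γ) := by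
  have hup : ∀ᵐ ω ∂μ, ∀ δ, γ < δ → ∀ᶠ n : ℕ in atTop, X n ω / n < δ := by
    filter_upwards [ae_all_iff.2 hblock] with ω hω δ hδ
    obtain ⟨N, hN1, hN0⟩ :=
      ((hlim.eventually_lt_const hδ).and (eventually_ne_atTop 0)).exists
    exact eventually_subadditive_div_le h0 hsub hN0 (by simpa using hω 1) (hω N) hN1
  have hγ0 : 0 ≤ γ := ge_of_tendsto hlim (Eventually.of_forall fun n =>
    div_nonneg (integral_nonneg fun ω => hnn n ω) (Nat.cast_nonneg n))
  have hlow : ∀ α, 0 ≤ α → α < γ → ∀ᵐ ω ∂μ, ∀ q : ℚ, (q : ℝ) < α →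
      ∀ᶠ n : ℕ in atTop, n * (q : ℝ) ≤ X n ω := by
    intro α hα0 hαγ
    set E : Set Ω := {ω | ∃ q : ℚ, (q : ℝ) < α ∧ ∃ᶠ n : ℕ in atTop, X n ω < n * q} with hE
    have hEm : MeasurableSet E := by
      have : E = ⋃ q : ℚ, ⋃ _ : (q : ℝ) < α, ⋂ N : ℕ, ⋃ n : ℕ, ⋃ _ : N ≤ n,
          {ω | X n ω < n * (q : ℝ)} := by
        ext ω
        simp [hE, frequently_atTop]
      rw [this]
      exact MeasurableSet.iUnion fun q => MeasurableSet.iUnion fun _ => MeasurableSet.iInter fun N =>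
        MeasurableSet.iUnion fun n => MeasurableSet.iUnion fun _ =>
          measurableSet_lt (hX n) measurable_const
    -- Passing from `T ω` to `ω` adds one step of cost `X 1 ω`, which a slightly larger rational
    -- `q'` absorbs for large `n`.
    have hsubset : T ⁻¹' E ⊆ E := by
      rintro ω ⟨q, hq, hfr⟩
      obtain ⟨q', hq1, hq2⟩ := exists_rat_btwn hq
      refine ⟨q', hq2, ?_⟩
      have hev : ∀ᶠ n : ℕ in atTop, X 1 ω + n * (q : ℝ) < (n + 1 : ℕ) * (q' : ℝ) := by
        have ht : Tendsto (fun n : ℕ => (n : ℝ) * ((q' : ℝ) - q)) atTop atTop :=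
          tendsto_natCast_atTop_atTop.atTop_mul_const (by linarith)
        filter_upwards [ht.eventually_gt_atTop (X 1 ω - q')] with n hn
        push_cast
        linarith
      refine (tendsto_add_atTop_nat 1).frequently ((hfr.and_eventually hev).mono ?_)
      rintro n ⟨h1, h2⟩
      have h3 := hsub 1 n ω
      rw [add_comm 1 n, Function.iterate_one] at h3
      linarith
    have hEinv : T ⁻¹' E =ᵐ[μ] E :=
      ae_eq_of_subset_of_measure_ge hsubset (hT.measure_preimage hEm.nullMeasurableSet).ge
        (hT.measurable hEm).nullMeasurableSet (measure_ne_top _ _)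
    have hbound : ∀ ε > 0, γ ≤ μ.real E * α + (1 - μ.real E) * (γ + ε) := by
      intro ε hε
      classical
      have hθi : ∫ ω, E.piecewise (fun _ => α) (fun _ => γ + ε) ω ∂μ =
          μ.real E * α + (1 - μ.real E) * (γ + ε) := by
        rw [integral_piecewise hEm (integrable_const _).integrableOn
          (integrable_const _).integrableOn]
        simp [measureReal_compl hEm]
      rw [← hθi]
      refine le_integral_of_stopping hT hX h0 hnn hsub hint hγ
        (measurable_const.piecewise hEm measurable_const)
        (Integrable.piecewise hEm (integrable_const _).integrableOn
          (integrable_const _).integrableOn) ?_ ?_ ?_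
      · intro ω
        by_cases hω : ω ∈ E
        · simp [hω, hα0]
        · simp only [hω, not_false_eq_true, Set.piecewise_eq_of_notMem]
          linarith
      · filter_upwards [hEinv.mem_iff] with ω hω
        by_cases h : ω ∈ E
        · have : T ω ∈ E := hω.2 h
          simp [h, this]
        · have : T ω ∉ E := fun h' => h (hω.1 h')
          simp [h, this]
      · filter_upwards [hup] with ω hω
        by_cases h : ω ∈ E
        · obtain ⟨q, hq, hfr⟩ := id h
          obtain ⟨n, h1, h2⟩ := (hfr.and_eventually (eventually_ge_atTop 1)).exists
          refine ⟨n, h2, h1.le.trans ?_⟩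
          simp only [h, Set.piecewise_eq_of_mem]
          gcongr
        · obtain ⟨n, h1, h2⟩ := ((hω (γ + ε) (by linarith)).and (eventually_ge_atTop 1)).exists
          refine ⟨n, h2, ?_⟩
          simp only [h, not_false_eq_true, Set.piecewise_eq_of_notMem]
          rw [div_lt_iff₀ (by exact_mod_cast h2)] at h1
          linarith
    have hE0 : μ.real E = 0 := by
      by_contra hne
      have hpos : 0 < μ.real E := lt_of_le_of_ne measureReal_nonneg (Ne.symm hne)
      have h1 : μ.real E ≤ 1 := measureReal_le_one
      have h2 : 0 < μ.real E * (γ - α) := mul_pos hpos (by linarith)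
      -- The bound gives `μ(E) (γ - α) ≤ (1 - μ(E)) ε ≤ ε`, and this `ε` is half of the left side.
      have h3 := hbound (μ.real E * (γ - α) / 2) (by linarith)
      nlinarith
    have hE1 : ∀ᵐ ω ∂μ, ω ∉ E := by
      rw [measureReal_eq_zero_iff] at hE0
      exact measure_eq_zero_iff_ae_notMem.1 hE0
    filter_upwards [hE1] with ω hω q hq
    by_contra hcon
    exact hω ⟨q, hq, (not_eventually.1 hcon).mono fun n hn => not_le.1 hn⟩
  have hlow' : ∀ᵐ ω ∂μ, ∀ q : ℚ, ∀ α : ℚ, (0 : ℝ) ≤ α → (α : ℝ) < γ → (q : ℝ) < α →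
      ∀ᶠ n : ℕ in atTop, n * (q : ℝ) ≤ X n ω := by
    have : ∀ α : ℚ, ∀ᵐ ω ∂μ, (0 : ℝ) ≤ α → (α : ℝ) < γ → ∀ q : ℚ, (q : ℝ) < α →
        ∀ᶠ n : ℕ in atTop, n * (q : ℝ) ≤ X n ω := by
      intro α
      by_cases h1 : (0 : ℝ) ≤ α
      · by_cases h2 : (α : ℝ) < γ
        · filter_upwards [hlow α h1 h2] with ω hω _ _ using hω
        · exact ae_of_all _ fun ω _ h => absurd h h2
      · exact ae_of_all _ fun ω h => absurd h h1
    filter_upwards [ae_all_iff.2 this] with ω hω q α h1 h2 h3 using hω α h1 h2 q h3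
  filter_upwards [hup, hlow'] with ω hω1 hω2
  refine tendsto_order.2 ⟨fun β hβ => ?_, hω1⟩
  rcases lt_or_ge β 0 with hβ0 | hβ0
  · exact Eventually.of_forall fun n => hβ0.trans_le (div_nonneg (hnn n ω) (Nat.cast_nonneg n))
  · obtain ⟨α, h1, h2⟩ := exists_rat_btwn hβ
    obtain ⟨q, h3, h4⟩ := exists_rat_btwn h1
    filter_upwards [hω2 q α (hβ0.trans h1.le) h2 h4, eventually_gt_atTop 0] with n hn hn0
    have : (0 : ℝ) < n := by exact_mod_cast hn0
    rw [lt_div_iff₀ this]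
    nlinarith

end Subadditive

/-! ### Measurability of first-passage values -/

theorem measurable_firstPassage {α : Type*} {mα : MeasurableSpace α} {h v : α → ℕ → ℕ → ℝ}
    {a b m n : ℕ} (hh : ∀ i j, a < i → i ≤ m → Measurable fun x => h x i j)
    (hv : ∀ i j, b < j → j ≤ n → Measurable fun x => v x i j) :
    Measurable fun x => firstPassage (h x) (v x) a b m n := by
  refine Measurable.iInf fun π => ?_
  have key : ∀ {i j : ℕ} (π : UpRightPath a b i j), i ≤ m → j ≤ n →
      Measurable fun x => π.weight (h x) (v x) := by
    intro i j π
    induction π with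
    | nil => intro _ _; exact measurable_const
    | @right i j π ih =>
      intro hi hj
      exact (ih (by omega) hj).add (hh _ _ (Nat.lt_succ_of_le π.le_end.1) hi)
    | @up i j π ih =>
      intro hi hj
      exact (ih hi (by omega)).add (hv _ _ (Nat.lt_succ_of_le π.le_end.2) hj)
  exact key π le_rfl le_rfl

/-! ### Horizontal first passage in the space of weights -/

section Horizontal

/-- First-passage value for the horizontal weights `max (u (i, j)) 0` and vertical weights `0`. -/
noncomputable def passageArray (u : ℕ × ℕ → ℝ) (a b m n : ℕ) : ℝ :=
  firstPassage (fun i j => max (u (i, j)) 0) (fun _ _ => 0) a b m n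

/-- Translation of an array of weights. -/
def shiftArray (s t : ℕ) (u : ℕ × ℕ → ℝ) : ℕ × ℕ → ℝ := fun k => u (s + k.1, t + k.2)

theorem passageArray_nonneg (u : ℕ × ℕ → ℝ) (a b m n : ℕ) : 0 ≤ passageArray u a b m n :=
  firstPassage_nonneg (fun _ _ => le_max_right _ _) (fun _ _ => le_rfl)

theorem passageArray_shift (u : ℕ × ℕ → ℝ) (s t : ℕ) {a b m n : ℕ} (hm : a ≤ m) (hn : b ≤ n) :
    passageArray u (s + a) (t + b) (s + m) (t + n) = passageArray (shiftArray s t u) a b m n :=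
  firstPassage_shift s t hm hn

theorem passageArray_triangle (u : ℕ × ℕ → ℝ) (m n m' n' : ℕ) :
    passageArray u 0 0 (m + m') (n + n') ≤
      passageArray u 0 0 m n + passageArray (shiftArray m n u) 0 0 m' n' := by
  rw [← passageArray_shift u m n (Nat.zero_le m') (Nat.zero_le n')]
  exact firstPassage_triangle (Nat.zero_le _) (Nat.zero_le _) (Nat.le_add_right _ _)
    (Nat.le_add_right _ _)

theorem passageArray_le_sum (u : ℕ × ℕ → ℝ) (m n : ℕ) :
    passageArray u 0 0 m n ≤ ∑ l ∈ Finset.range m, max (u (l + 1, 0)) 0 :=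
  (firstPassage_zero_antitone (Nat.zero_le _) le_rfl (Nat.zero_le n)).trans
    (firstPassage_horizontal_le m)

theorem passageArray_zero_left (u : ℕ × ℕ → ℝ) (n : ℕ) : passageArray u 0 0 0 n = 0 :=
  le_antisymm (by simpa using passageArray_le_sum u 0 n) (passageArray_nonneg _ _ _ _ _)

theorem passageArray_le {u : ℕ × ℕ → ℝ} {m m' n n' : ℕ} (hm : m ≤ m') (hn : n' ≤ n) :
    passageArray u 0 0 m n ≤ passageArray u 0 0 m' n' :=
  (firstPassage_zero_antitone (Nat.zero_le _) (Nat.zero_le _) hn).trans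
    (firstPassage_zero_monotone (fun _ _ => le_max_right _ _) (Nat.zero_le _) (Nat.zero_le _) hm)

theorem measurable_passageArray (a b m n : ℕ) : Measurable fun u => passageArray u a b m n :=
  measurable_firstPassage (fun _ _ _ _ => by fun_prop) fun _ _ _ _ => measurable_const

theorem iterate_shiftArray (a b m : ℕ) : (shiftArray a b)^[m] = shiftArray (m * a) (m * b) := by
  induction m with
  | zero => ext u k; simp [shiftArray]
  | succ m ih =>
    ext u k
    rw [Function.iterate_succ_apply, ih]
    simp only [shiftArray]
    congr 2 <;> ring

variable (ν : Measure ℝ)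

theorem measurePreserving_shiftArray [IsProbabilityMeasure ν] (s t : ℕ) :
    MeasurePreserving (shiftArray s t) (Measure.infinitePi fun _ : ℕ × ℕ => ν)
      (Measure.infinitePi fun _ : ℕ × ℕ => ν) where
  measurable := measurable_pi_iff.2 fun k => measurable_pi_apply _
  map_eq := Measure.map_infinitePi_infinitePi_of_inj (P := fun _ : ℕ × ℕ => ν)
    (f := fun k : ℕ × ℕ => (s + k.1, t + k.2)) fun k l hkl => by
      simp only [Prod.mk.injEq] at hkl
      exact Prod.ext (by omega) (by omega)

/-- Expected horizontal first-passage value. -/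
noncomputable def meanPassage (m n : ℕ) : ℝ :=
  ∫ u, passageArray u 0 0 m n ∂(Measure.infinitePi fun _ : ℕ × ℕ => ν)

variable {ν}

theorem integrable_eval_max [IsProbabilityMeasure ν] (hν : Integrable (fun x => x) ν) (k : ℕ × ℕ) :
    Integrable (fun u : ℕ × ℕ → ℝ => max (u k) 0) (Measure.infinitePi fun _ : ℕ × ℕ => ν) := by
  have h := (measurePreserving_eval_infinitePi (fun _ : ℕ × ℕ => ν) k).integrable_comp_of_integrable
    (hν.sup (integrable_zero _ _ _))
  exact h

theorem integral_eval_max [IsProbabilityMeasure ν] (k : ℕ × ℕ) :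
    ∫ u : ℕ × ℕ → ℝ, max (u k) 0 ∂(Measure.infinitePi fun _ : ℕ × ℕ => ν) = ∫ x, max x 0 ∂ν := by
  have hk := measurePreserving_eval_infinitePi (fun _ : ℕ × ℕ => ν) k
  have := integral_map (μ := Measure.infinitePi fun _ : ℕ × ℕ => ν) hk.measurable.aemeasurable
    (f := fun x : ℝ => max x 0) (by fun_prop)
  rw [hk.map_eq] at this
  exact this.symm

theorem integrable_passageArray [IsProbabilityMeasure ν] (hν : Integrable (fun x => x) ν) (m n : ℕ) :
    Integrable (fun u => passageArray u 0 0 m n) (Measure.infinitePi fun _ : ℕ × ℕ => ν) := by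
  refine Integrable.mono' (integrable_finsetSum (Finset.range m) fun l _ =>
    integrable_eval_max hν (l + 1, 0)) (measurable_passageArray _ _ _ _).aestronglyMeasurable
    (ae_of_all _ fun u => ?_)
  rw [Real.norm_of_nonneg (passageArray_nonneg _ _ _ _ _)]
  exact passageArray_le_sum u m n

theorem meanPassage_nonneg (m n : ℕ) : 0 ≤ meanPassage ν m n :=
  integral_nonneg fun u => passageArray_nonneg u _ _ _ _

theorem meanPassage_le [IsProbabilityMeasure ν] (hν : Integrable (fun x => x) ν) (m n : ℕ) :
    meanPassage ν m n ≤ m * ∫ x, max x 0 ∂ν := by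
  refine (integral_mono (integrable_passageArray hν m n) (integrable_finsetSum (Finset.range m)
    fun l _ => integrable_eval_max hν (l + 1, 0)) fun u => passageArray_le_sum u m n).trans ?_
  rw [integral_finsetSum _ fun l _ => integrable_eval_max hν (l + 1, 0)]
  simp [integral_eval_max]

theorem meanPassage_add_le [IsProbabilityMeasure ν] (hν : Integrable (fun x => x) ν) (m n m' n' : ℕ) :
    meanPassage ν (m + m') (n + n') ≤ meanPassage ν m n + meanPassage ν m' n' := by
  have hS := measurePreserving_shiftArray ν m n
  have h1 : ∫ u, passageArray (shiftArray m n u) 0 0 m' n'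
      ∂(Measure.infinitePi fun _ : ℕ × ℕ => ν) = meanPassage ν m' n' := by
    have := integral_map (μ := Measure.infinitePi fun _ : ℕ × ℕ => ν) hS.measurable.aemeasurable
      (f := fun u => passageArray u 0 0 m' n')
      (measurable_passageArray _ _ _ _).aestronglyMeasurable
    rw [hS.map_eq] at this
    exact this.symm
  have hi : Integrable (fun u => passageArray (shiftArray m n u) 0 0 m' n')
      (Measure.infinitePi fun _ : ℕ × ℕ => ν) :=
    hS.integrable_comp_of_integrable (integrable_passageArray hν m' n')
  rw [← h1, meanPassage, meanPassage, ← integral_add (integrable_passageArray hν m n) hi]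
  exact integral_mono (integrable_passageArray hν _ _) ((integrable_passageArray hν m n).add hi)
    fun u => passageArray_triangle u m n m' n'

/-- Strong law for the passage values of consecutive blocks. -/
theorem ae_tendsto_sum_blocks [IsProbabilityMeasure ν] (hν : Integrable (fun x => x) ν) (a b : ℕ) :
    ∀ᵐ u ∂(Measure.infinitePi fun _ : ℕ × ℕ => ν), Tendsto (fun k : ℕ =>
      (∑ t ∈ Finset.range k, passageArray u (t * a) (t * b) ((t + 1) * a) ((t + 1) * b)) / k)
      atTop (𝓝 (meanPassage ν a b)) := by
  set P := Measure.infinitePi fun _ : ℕ × ℕ => ν with hP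
  set Y : ℕ → (ℕ × ℕ → ℝ) → ℝ :=
    fun t u => passageArray u (t * a) (t * b) ((t + 1) * a) ((t + 1) * b) with hY
  have hYm : ∀ t, Measurable (Y t) := fun t => measurable_passageArray _ _ _ _
  have hY0 : Y 0 = fun u => passageArray u 0 0 a b := by simp [hY]
  have hYS : ∀ t, Y t = Y 0 ∘ shiftArray (t * a) (t * b) := by
    intro t
    ext u
    rw [hY0, Function.comp_apply, ← passageArray_shift u _ _ (Nat.zero_le _) (Nat.zero_le _)]
    simp only [hY, add_zero, Nat.succ_mul]
  have hid : ∀ t, IdentDistrib (Y t) (Y 0) P P := fun t => by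
    refine ⟨(hYm t).aemeasurable, (hYm 0).aemeasurable, ?_⟩
    have hS := measurePreserving_shiftArray ν (t * a) (t * b)
    rw [hYS t, ← Measure.map_map (hYm 0) hS.measurable, hS.map_eq]
  have hcoord : iIndepFun (fun (k : ℕ × ℕ) (u : ℕ × ℕ → ℝ) => u k) P :=
    iIndepFun_infinitePi (P := fun _ : ℕ × ℕ => ν) (X := fun _ x => x) fun _ => measurable_id
  have hindep : Pairwise (Function.onFun (· ⟂ᵢ[P] ·) Y) := by
    intro s t hst
    -- A block uses only the horizontal edges that end in its own columns, and these column ranges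
    -- are disjoint for different blocks.
    let S : ℕ → Set (ℕ × ℕ) := fun t => {k | t * a < k.1 ∧ k.1 ≤ (t + 1) * a}
    have hdis : Disjoint (S s) (S t) := by
      rw [Set.disjoint_left]
      rintro k ⟨h1, h2⟩ ⟨h3, h4⟩
      have h5 : s * a < (t + 1) * a := h1.trans_le h4
      have h6 : t * a < (s + 1) * a := h3.trans_le h2
      have := lt_of_mul_lt_mul_right h5 (Nat.zero_le a)
      have := lt_of_mul_lt_mul_right h6 (Nat.zero_le a)
      omega
    have hmeas : ∀ t, Measurable[⨆ k ∈ S t, MeasurableSpace.comap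
        (fun u : ℕ × ℕ → ℝ => u k) inferInstance] (Y t) := by
      intro t
      refine measurable_firstPassage (fun i j hi hi' => ?_) fun _ _ _ _ => measurable_const
      have h1 : Measurable[⨆ k ∈ S t, MeasurableSpace.comap
        (fun u : ℕ × ℕ → ℝ => u k) inferInstance] (fun u : ℕ × ℕ → ℝ => u (i, j)) :=
        (comap_measurable (fun u : ℕ × ℕ → ℝ => u (i, j))).mono
          (le_iSup₂_of_le (f := fun k (_ : k ∈ S t) => MeasurableSpace.comap
            (fun u : ℕ × ℕ → ℝ => u k) inferInstance) (i, j) ⟨hi, hi'⟩ le_rfl) le_rfl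
      exact h1.max measurable_const
    have h := indep_iSup_of_disjoint (fun k => (measurable_pi_apply k).comap_le) hcoord hdis
    exact indep_of_indep_of_le_left (indep_of_indep_of_le_right h (hmeas t).comap_le)
      (hmeas s).comap_le
  have := strong_law_ae_real Y (by rw [hY0]; exact integrable_passageArray hν a b) hindep hid
  rw [hY0] at this
  exact this

/-! ### Rates in integer directions -/

theorem exists_rate [IsProbabilityMeasure ν] (hν : Integrable (fun x => x) ν) : ∃ γ : ℕ → ℕ → ℝ,
    (∀ a b n : ℕ, n * γ a b ≤ meanPassage ν (n * a) (n * b)) ∧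
    ∀ a b : ℕ, Tendsto (fun n : ℕ => meanPassage ν (n * a) (n * b) / n) atTop (𝓝 (γ a b)) := by
  have hsub : ∀ a b, Subadditive fun n => meanPassage ν (n * a) (n * b) := fun a b m n => by
    simp only [add_mul]
    exact meanPassage_add_le hν _ _ _ _
  have hbdd : ∀ a b, BddBelow (Set.range fun n : ℕ => meanPassage ν (n * a) (n * b) / n) :=
    fun a b => ⟨0, by
      rintro _ ⟨n, rfl⟩
      exact div_nonneg (meanPassage_nonneg _ _) (Nat.cast_nonneg n)⟩
  refine ⟨fun a b => (hsub a b).lim, fun a b n => ?_, fun a b => (hsub a b).tendsto_lim (hbdd a b)⟩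
  rcases eq_or_ne n 0 with rfl | hn
  · simpa using meanPassage_nonneg 0 0
  · have := (hsub a b).lim_le_div (hbdd a b) hn
    rw [le_div_iff₀ (by positivity)] at this
    linarith

theorem ae_tendsto_passageArray [IsProbabilityMeasure ν] (hν : Integrable (fun x => x) ν) {γ : ℝ} {a b : ℕ}
    (hγ : ∀ n : ℕ, n * γ ≤ meanPassage ν (n * a) (n * b))
    (hlim : Tendsto (fun n : ℕ => meanPassage ν (n * a) (n * b) / n) atTop (𝓝 γ)) :
    ∀ᵐ u ∂(Measure.infinitePi fun _ : ℕ × ℕ => ν),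
      Tendsto (fun n : ℕ => passageArray u 0 0 (n * a) (n * b) / n) atTop (𝓝 γ) := by
  refine ae_tendsto_of_subadditive (T := shiftArray a b)
    (X := fun n u => passageArray u 0 0 (n * a) (n * b)) (measurePreserving_shiftArray ν a b)
    (fun n => measurable_passageArray _ _ _ _) (fun u => by simp [passageArray_zero_left])
    (fun n u => passageArray_nonneg _ _ _ _ _) (fun m n u => ?_)
    (integrable_passageArray hν _ _) hγ hlim fun N => ?_
  · rw [iterate_shiftArray, add_mul, add_mul]
    exact passageArray_triangle _ _ _ _ _
  · filter_upwards [ae_tendsto_sum_blocks hν (N * a) (N * b)] with u hu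
    refine hu.congr fun k => ?_
    congr 1
    refine Finset.sum_congr rfl fun t _ => ?_
    rw [iterate_shiftArray, ← passageArray_shift u _ _ (Nat.zero_le _) (Nat.zero_le _)]
    congr 1 <;> ring

theorem rate_add_le [IsProbabilityMeasure ν] (hν : Integrable (fun x => x) ν) {γ : ℕ → ℕ → ℝ}
    (hlim : ∀ a b : ℕ,
      Tendsto (fun n : ℕ => meanPassage ν (n * a) (n * b) / n) atTop (𝓝 (γ a b)))
    (a b a' b' : ℕ) : γ (a + a') (b + b') ≤ γ a b + γ a' b' := by
  refine le_of_tendsto_of_tendsto' (hlim _ _) ((hlim a b).add (hlim a' b')) fun n => ?_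
  rw [← add_div, mul_add, mul_add]
  gcongr
  exact meanPassage_add_le hν _ _ _ _

theorem rate_mul {γ : ℕ → ℕ → ℝ}
    (hlim : ∀ a b : ℕ,
      Tendsto (fun n : ℕ => meanPassage ν (n * a) (n * b) / n) atTop (𝓝 (γ a b)))
    {k : ℕ} (hk : k ≠ 0) (a b : ℕ) : γ (k * a) (k * b) = k * γ a b := by
  refine tendsto_nhds_unique (hlim (k * a) (k * b)) ?_
  have h1 : Tendsto (fun n : ℕ => n * k) atTop atTop :=
    tendsto_id.atTop_mul_const' (Nat.pos_of_ne_zero hk)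
  refine (((hlim a b).comp h1).const_mul (k : ℝ)).congr fun n => ?_
  simp only [Function.comp_apply, mul_assoc]
  rcases eq_or_ne n 0 with rfl | hn
  · simp
  · push_cast
    field_simp

/-- A continuity estimate for the rate. Increasing `a` by one costs at most the mean weight. For the
other coordinate, `(b + 1) • (a, b) = b • (a, b + 1) + (a, 0)` with homogeneity and subadditivity
bounds `γ a b` by `γ a (b + 1)` plus `a / b` mean weights. -/
theorem rate_succ_left_le [IsProbabilityMeasure ν] (hν : Integrable (fun x => x) ν) {γ : ℕ → ℕ → ℝ}
    (hγ : ∀ a b n : ℕ, n * γ a b ≤ meanPassage ν (n * a) (n * b))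
    (hlim : ∀ a b : ℕ,
      Tendsto (fun n : ℕ => meanPassage ν (n * a) (n * b) / n) atTop (𝓝 (γ a b)))
    (a : ℕ) {b : ℕ} (hb : b ≠ 0) :
    γ (a + 1) b ≤ γ a (b + 1) + (1 + a / b) * ∫ x, max x 0 ∂ν := by
  set c := ∫ x, max x 0 ∂ν
  have hc : ∀ a : ℕ, γ a 0 ≤ a * c := fun a => by
    have h1 := hγ a 0 1
    have h2 := meanPassage_le hν (1 * a) (1 * 0)
    simp only [Nat.cast_one, one_mul] at h1 h2
    exact h1.trans h2
  have h1 : γ (a + 1) b ≤ γ a b + c := by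
    have := rate_add_le hν hlim a b 1 0
    have h2 := hc 1
    simp only [Nat.cast_one, one_mul, add_zero] at this h2
    linarith
  have h2 : (b + 1 : ℝ) * γ a b ≤ b * γ a (b + 1) + a * c := by
    have e1 := rate_mul hlim (Nat.succ_ne_zero b) a b
    have e2 := rate_mul hlim hb a (b + 1)
    have h3 := rate_add_le hν hlim (b * a) (b * (b + 1)) a 0
    have e3 : γ ((b + 1) * a) ((b + 1) * b) = γ (b * a + a) (b * (b + 1) + 0) := by
      congr 1 <;> ring
    rw [Nat.succ_eq_add_one, e3] at e1
    push_cast at e1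
    linarith [hc a]
  have h0 : 0 ≤ γ a b := ge_of_tendsto (hlim a b) (Eventually.of_forall fun n =>
    div_nonneg (meanPassage_nonneg _ _) (Nat.cast_nonneg n))
  have hb' : (0 : ℝ) < b := by positivity
  have h3 : γ a b ≤ γ a (b + 1) + a / b * c := by
    have : (b : ℝ) * γ a b ≤ b * (γ a (b + 1) + a / b * c) := by
      have e : (b : ℝ) * (γ a (b + 1) + a / b * c) = b * γ a (b + 1) + a * c := by
        field_simp
      rw [e]
      linarith
    exact le_of_mul_le_mul_left this hb'
  linarith

/-! ### Limits in real directions -/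

/-- The strict inequality leaves linear slack, which absorbs the rounding of `n` to a multiple of
`N`. -/
theorem eventually_floor_le_natDiv_mul {x : ℝ} {N a : ℕ} (hN : N ≠ 0) (ha : N * x < a) :
    ∀ᶠ n : ℕ in atTop, ⌊(n : ℝ) * x⌋₊ ≤ n / N * a := by
  have hN' : (0 : ℝ) < N := by positivity
  have h1 := (tendsto_natDiv_div_self hN).mul_const (a : ℝ)
  have h2 : x < 1 / N * a := by
    rw [one_div_mul_eq_div, lt_div_iff₀ hN']
    linarith
  filter_upwards [h1.eventually_const_lt h2, eventually_gt_atTop 0] with n hn hn0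
  have hn0' : (0 : ℝ) < n := by exact_mod_cast hn0
  refine Nat.floor_le_of_le ?_
  rw [div_mul_eq_mul_div, lt_div_iff₀ hn0'] at hn
  push_cast
  linarith

theorem natDiv_mul_le_floor {y : ℝ} {N b : ℕ} (hy : 0 ≤ y) (hb : b ≤ N * y) (n : ℕ) :
    n / N * b ≤ ⌊(n : ℝ) * y⌋₊ := by
  refine Nat.le_floor ?_
  have h1 : ((n / N : ℕ) : ℝ) * N ≤ n := by exact_mod_cast Nat.div_mul_le_self n N
  push_cast
  calc ((n / N : ℕ) : ℝ) * b ≤ ((n / N : ℕ) : ℝ) * (N * y) := by gcongr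
    _ = ((n / N : ℕ) : ℝ) * N * y := by ring
    _ ≤ n * y := by gcongr

/-- Monotonicity in both coordinates squeezes the passage value between integer directions rounded
to make it cheaper (`α N`) and dearer (`β N`). Their gap is `O(1 / N)`, because for `y > 0` the
ratio of the coordinates stays bounded. The second conclusion supplies the block sizes used for the
upper bound on `F`. -/
theorem exists_limit_of_pos [IsProbabilityMeasure ν] (hν : Integrable (fun x => x) ν) {γ : ℕ → ℕ → ℝ}
    (hγ : ∀ a b n : ℕ, n * γ a b ≤ meanPassage ν (n * a) (n * b))
    (hlim : ∀ a b : ℕ,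
      Tendsto (fun n : ℕ => meanPassage ν (n * a) (n * b) / n) atTop (𝓝 (γ a b)))
    {x y : ℝ} (hx : 0 ≤ x) (hy : 0 < y) : ∃ c : ℝ,
    (∀ᵐ u ∂(Measure.infinitePi fun _ : ℕ × ℕ => ν), Tendsto (fun n : ℕ =>
      passageArray u 0 0 ⌊(n : ℝ) * x⌋₊ ⌊(n : ℝ) * y⌋₊ / n) atTop (𝓝 c)) ∧
    ∀ ε > 0, ∃ N a b : ℕ, N ≠ 0 ∧ N * x < a ∧ b ≤ N * y ∧ γ a b ≤ N * (c + ε) := by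
  set α : ℕ → ℝ := fun N => γ ⌊(N : ℝ) * x⌋₊ (⌊(N : ℝ) * y⌋₊ + 1) / N with hα
  set β : ℕ → ℝ := fun N => γ (⌊(N : ℝ) * x⌋₊ + 1) ⌊(N : ℝ) * y⌋₊ / N with hβ
  have hae : ∀ᵐ u ∂(Measure.infinitePi fun _ : ℕ × ℕ => ν), ∀ a b : ℕ,
      Tendsto (fun n : ℕ => passageArray u 0 0 (n * a) (n * b) / n) atTop (𝓝 (γ a b)) :=
    ae_all_iff.2 fun a => ae_all_iff.2 fun b => ae_tendsto_passageArray hν (hγ a b) (hlim a b)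
  have hlow : ∀ u : ℕ × ℕ → ℝ, (∀ a b : ℕ, Tendsto
      (fun n : ℕ => passageArray u 0 0 (n * a) (n * b) / n) atTop (𝓝 (γ a b))) → ∀ N ≠ 0,
      ∀ δ < α N, ∀ᶠ n : ℕ in atTop,
        δ < passageArray u 0 0 ⌊(n : ℝ) * x⌋₊ ⌊(n : ℝ) * y⌋₊ / n := by
    intro u hu N hN δ hδ
    have h1 := tendsto_comp_natDiv (u := fun n => passageArray u 0 0 (n * ⌊(N : ℝ) * x⌋₊)
      (n * (⌊(N : ℝ) * y⌋₊ + 1))) (hu _ _) hN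
    filter_upwards [h1.eventually_const_lt hδ, eventually_floor_le_natDiv_mul hN
      (a := ⌊(N : ℝ) * y⌋₊ + 1) (by exact_mod_cast Nat.lt_floor_add_one ((N : ℝ) * y))] with n hn h2
    refine hn.trans_le ?_
    gcongr
    exact passageArray_le (natDiv_mul_le_floor hx (Nat.floor_le (by positivity)) n) h2
  have hupp : ∀ u : ℕ × ℕ → ℝ, (∀ a b : ℕ, Tendsto
      (fun n : ℕ => passageArray u 0 0 (n * a) (n * b) / n) atTop (𝓝 (γ a b))) → ∀ N ≠ 0,
      ∀ δ, β N < δ → ∀ᶠ n : ℕ in atTop,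
        passageArray u 0 0 ⌊(n : ℝ) * x⌋₊ ⌊(n : ℝ) * y⌋₊ / n < δ := by
    intro u hu N hN δ hδ
    have h1 := tendsto_comp_natDiv (u := fun n => passageArray u 0 0 (n * (⌊(N : ℝ) * x⌋₊ + 1))
      (n * ⌊(N : ℝ) * y⌋₊)) (hu _ _) hN
    filter_upwards [h1.eventually_lt_const hδ, eventually_floor_le_natDiv_mul hN
      (a := ⌊(N : ℝ) * x⌋₊ + 1) (by exact_mod_cast Nat.lt_floor_add_one ((N : ℝ) * x))] with n hn h2
    refine lt_of_le_of_lt ?_ hn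
    gcongr
    exact passageArray_le h2 (natDiv_mul_le_floor hy.le (Nat.floor_le (by positivity)) n)
  have hαβ : ∀ N ≠ 0, ∀ M ≠ 0, α N ≤ β M := by
    intro N hN M hM
    obtain ⟨u, hu⟩ := hae.exists
    by_contra! hlt
    obtain ⟨δ, h1, h2⟩ := exists_between hlt
    obtain ⟨n, h3, h4⟩ := ((hlow u hu N hN δ h2).and (hupp u hu M hM δ h1)).exists
    exact lt_asymm h3 h4
  have hdiff : ∀ ε > 0, ∃ N ≠ 0, β N < α N + ε := by
    intro ε hε
    set c := ∫ x, max x 0 ∂ν with hc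
    have hc0 : 0 ≤ c := integral_nonneg fun x => le_max_right x 0
    have ht : Tendsto (fun N : ℕ => ((1 + 2 * x / y) * c) / (N : ℝ)) atTop (𝓝 0) :=
      tendsto_const_div_atTop_nhds_zero_nat _
    have hNy : Tendsto (fun N : ℕ => (N : ℝ) * y) atTop atTop :=
      tendsto_natCast_atTop_atTop.atTop_mul_const hy
    obtain ⟨N, ⟨h1, h2⟩, hN⟩ := (((ht.eventually_lt_const hε).and
      (hNy.eventually_ge_atTop 1)).and (eventually_ne_atTop 0)).exists
    refine ⟨N, hN, ?_⟩
    have hb1 : 1 ≤ ⌊(N : ℝ) * y⌋₊ := (Nat.one_le_floor_iff _).2 h2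
    have hb1' : (1 : ℝ) ≤ (⌊(N : ℝ) * y⌋₊ : ℝ) := by exact_mod_cast hb1
    have hN' : (0 : ℝ) < N := by positivity
    have hr := rate_succ_left_le hν hγ hlim ⌊(N : ℝ) * x⌋₊ (b := ⌊(N : ℝ) * y⌋₊) (by omega)
    have hratio : (⌊(N : ℝ) * x⌋₊ : ℝ) / (⌊(N : ℝ) * y⌋₊ : ℝ) ≤ 2 * x / y := by
      rw [div_le_div_iff₀ (by linarith) hy]
      have h3 : (⌊(N : ℝ) * x⌋₊ : ℝ) ≤ N * x := Nat.floor_le (by positivity)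
      have h4 : (N : ℝ) * y ≤ 2 * ⌊(N : ℝ) * y⌋₊ := by
        linarith [Nat.lt_floor_add_one ((N : ℝ) * y)]
      calc (⌊(N : ℝ) * x⌋₊ : ℝ) * y ≤ N * x * y := by gcongr
        _ = x * (N * y) := by ring
        _ ≤ x * (2 * ⌊(N : ℝ) * y⌋₊) := by gcongr
        _ = 2 * x * ⌊(N : ℝ) * y⌋₊ := by ring
    calc β N ≤ (γ ⌊(N : ℝ) * x⌋₊ (⌊(N : ℝ) * y⌋₊ + 1) + (1 + 2 * x / y) * c) / N := by
          simp only [hβ]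
          gcongr
          refine hr.trans ?_
          gcongr
      _ = α N + ((1 + 2 * x / y) * c) / N := by rw [add_div]
      _ < α N + ε := by linarith
  set c := ⨆ N : ℕ, α (N + 1) with hc
  have hbdd : BddAbove (Set.range fun N : ℕ => α (N + 1)) :=
    ⟨β 1, by rintro _ ⟨N, rfl⟩; exact hαβ _ (Nat.succ_ne_zero N) 1 one_ne_zero⟩
  have hαc : ∀ N ≠ 0, α N ≤ c := fun N hN => by
    obtain ⟨M, rfl⟩ := Nat.exists_eq_succ_of_ne_zero hN
    exact le_ciSup hbdd M
  have hcβ : ∀ N ≠ 0, c ≤ β N := fun N hN => ciSup_le fun M => hαβ _ (Nat.succ_ne_zero M) N hN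
  refine ⟨c, ?_, fun ε hε => ?_⟩
  · filter_upwards [hae] with u hu
    refine tendsto_order.2 ⟨fun δ hδ => ?_, fun δ hδ => ?_⟩
    · obtain ⟨N, hN, h1⟩ := hdiff (c - δ) (by linarith)
      exact hlow u hu N hN δ (by linarith [hcβ N hN])
    · obtain ⟨N, hN, h1⟩ := hdiff (δ - c) (by linarith)
      exact hupp u hu N hN δ (by linarith [hαc N hN])
  · obtain ⟨N, hN, h1⟩ := hdiff ε hε
    refine ⟨N, ⌊(N : ℝ) * x⌋₊ + 1, ⌊(N : ℝ) * y⌋₊, hN,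
      by exact_mod_cast Nat.lt_floor_add_one ((N : ℝ) * x), Nat.floor_le (by positivity), ?_⟩
    have hN' : (0 : ℝ) < N := by positivity
    have h2 : β N ≤ c + ε := by linarith [hαc N hN]
    simp only [hβ] at h2
    rw [div_le_iff₀ hN'] at h2
    linarith

theorem exists_limit_on_axis [IsProbabilityMeasure ν] (hν : Integrable (fun x => x) ν) {γ : ℝ}
    (hγ : ∀ n : ℕ, n * γ ≤ meanPassage ν (n * 1) (n * 0))
    (hlim : Tendsto (fun n : ℕ => meanPassage ν (n * 1) (n * 0) / n) atTop (𝓝 γ)) {x : ℝ}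
    (hx : 0 ≤ x) :
    ∀ᵐ u ∂(Measure.infinitePi fun _ : ℕ × ℕ => ν), Tendsto (fun n : ℕ =>
      passageArray u 0 0 ⌊(n : ℝ) * x⌋₊ 0 / n) atTop (𝓝 (γ * x)) := by
  filter_upwards [ae_tendsto_passageArray hν hγ hlim] with u hu
  rcases hx.eq_or_lt with rfl | hx
  · simp [passageArray_zero_left]
  · have h1 : Tendsto (fun n : ℕ => (n : ℝ) * x) atTop atTop :=
      tendsto_natCast_atTop_atTop.atTop_mul_const hx
    have h2 : Tendsto (fun n : ℕ => ⌊(n : ℝ) * x⌋₊) atTop atTop := tendsto_nat_floor_atTop.comp h1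
    have h3 : Tendsto (fun n : ℕ => (⌊(n : ℝ) * x⌋₊ : ℝ) / n) atTop (𝓝 x) := by
      have := (tendsto_nat_floor_mul_div_atTop (R := ℝ) hx.le).comp tendsto_natCast_atTop_atTop
      refine this.congr fun n => ?_
      simp [mul_comm]
    refine ((hu.comp h2).mul h3).congr' ?_
    filter_upwards [h2.eventually_gt_atTop 0, eventually_gt_atTop 0] with n hn hn0
    have : (0 : ℝ) < (⌊(n : ℝ) * x⌋₊ : ℝ) := by exact_mod_cast hn
    simp only [Function.comp_apply, mul_one, mul_zero]
    field_simp

theorem exists_limitShape_array [IsProbabilityMeasure ν] (hν : Integrable (fun x => x) ν) : ∃ f : ℝ → ℝ → ℝ,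
    (∀ x y : ℝ, 0 ≤ x → 0 ≤ y → ∀ᵐ u ∂(Measure.infinitePi fun _ : ℕ × ℕ => ν), Tendsto (fun n : ℕ =>
      passageArray u 0 0 ⌊(n : ℝ) * x⌋₊ ⌊(n : ℝ) * y⌋₊ / n) atTop (𝓝 (f x y))) ∧
    ∀ x y : ℝ, 0 ≤ x → 0 < y → ∀ ε > 0, ∀ K : ℝ, ∃ N a b : ℕ, K < N ∧ N ≠ 0 ∧ N * x < a ∧ b ≤ N * y ∧
      meanPassage ν a b ≤ N * (f x y + ε) := by
  obtain ⟨γ, hγ, hlim⟩ := exists_rate hν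
  have h1 : ∀ x y : ℝ, ∃ c : ℝ, 0 ≤ x → 0 < y →
      (∀ᵐ u ∂(Measure.infinitePi fun _ : ℕ × ℕ => ν), Tendsto (fun n : ℕ =>
        passageArray u 0 0 ⌊(n : ℝ) * x⌋₊ ⌊(n : ℝ) * y⌋₊ / n) atTop (𝓝 c)) ∧
      ∀ ε > 0, ∃ N a b : ℕ, N ≠ 0 ∧ N * x < a ∧ b ≤ N * y ∧ γ a b ≤ N * (c + ε) := by
    intro x y
    by_cases h : 0 ≤ x ∧ 0 < y
    · obtain ⟨c, hc⟩ := exists_limit_of_pos hν hγ hlim h.1 h.2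
      exact ⟨c, fun _ _ => hc⟩
    · exact ⟨0, fun hx hy => absurd ⟨hx, hy⟩ h⟩
  choose c hc using h1
  -- The horizontal axis is separate because the squeeze needs `y > 0`; there the law along
  -- multiples of `(1, 0)` suffices.
  refine ⟨fun x y => if y = 0 then γ 1 0 * x else c x y, fun x y hx hy => ?_,
    fun x y hx hy ε hε K => ?_⟩
  · rcases hy.eq_or_lt with rfl | hy
    · simpa using exists_limit_on_axis hν (hγ 1 0) (hlim 1 0) hx
    · simpa [hy.ne'] using (hc x y hx hy).1
  · obtain ⟨N, a, b, hN, ha, hb, h2⟩ := (hc x y hx hy).2 (ε / 2) (by linarith)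
    have hN' : (0 : ℝ) < N := by positivity
    have hN1 : (1 : ℝ) ≤ N := by exact_mod_cast Nat.one_le_iff_ne_zero.2 hN
    have h3 : γ a b < N * (c x y + ε) := by nlinarith
    obtain ⟨M, ⟨h4, h5⟩, h6⟩ := (((hlim a b).eventually_lt_const h3).and
      (tendsto_natCast_atTop_atTop.eventually_gt_atTop (max K 0))).exists.imp fun M hM =>
        And.intro hM (le_max_right K 0 |>.trans_lt hM.2)
    have hM0 : M ≠ 0 := by rintro rfl; simp at h6
    -- Multiplying the block by a large `M` replaces the rate by an actual mean passage value and
    -- also pushes the scale beyond `K`.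
    refine ⟨M * N, M * a, M * b, ?_, mul_ne_zero hM0 hN, ?_, ?_, ?_⟩
    · push_cast
      nlinarith [le_max_left K 0]
    · push_cast
      nlinarith
    · push_cast
      nlinarith
    · rw [div_lt_iff₀ h6] at h4
      simp only [hy.ne', if_false]
      push_cast
      nlinarith

end Horizontal

/-! ### Concentration of the exit height -/

section ExitHeightBound

theorem measurable_exitHeight {α : Type*} {mα : MeasurableSpace α} {B : ℕ → ℕ → α → ℝ} {i j : ℕ}
    (hB : ∀ k l, k ≤ i → l ≤ j → Measurable (B k l)) :
    Measurable fun ω => exitHeight (fun k l => B k l ω) i j := by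
  induction i generalizing j with
  | zero => simp
  | succ i ihi =>
    induction j with
    | zero => simp
    | succ j ihj =>
      simp only [exitHeight_succ_succ]
      exact Measurable.ite (hB _ _ le_rfl le_rfl (measurableSet_singleton (1 : ℝ)))
        (ihj fun k l hk hl => hB k l hk (by omega)) (ihi fun k l hk hl => hB k l (by omega) hl)

/-- Near `z = 1`, `z > 1`, the exponential rate of the exit height in direction `(a, b)` is less
than `s`. -/
theorem exists_exponent {p : ℝ} (hp : p < 1) {a b s : ℕ}
    (hab : (1 - p) * b < p * a + (1 - p) * s) :
    ∃ z : ℝ, 1 < z ∧ z ^ b * ((1 - p) * z / (z - p)) ^ a < z ^ s := by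
  -- The difference of the two sides with the denominator cleared. It vanishes at `z = 1`, and the
  -- hypothesis `hab` says exactly that its derivative there is positive.
  set D : ℝ → ℝ := fun z => (z - p) ^ a * z ^ s - z ^ (a + b) * (1 - p) ^ a with hD
  have hq : 0 < 1 - p := by linarith
  have hder : HasDerivAt D ((a * (1 - p) ^ (a - 1) * 1) * 1 ^ s + (1 - p) ^ a * (s * 1 ^ (s - 1)) -
      ((a + b : ℕ) * 1 ^ (a + b - 1)) * (1 - p) ^ a) 1 :=
    ((((hasDerivAt_id (1 : ℝ)).sub_const p).pow a).mul (hasDerivAt_pow s 1)).sub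
      ((hasDerivAt_pow (a + b) 1).mul_const _)
  have hpos : 0 < (a * (1 - p) ^ (a - 1) * 1) * 1 ^ s + (1 - p) ^ a * (s * 1 ^ (s - 1)) -
      ((a + b : ℕ) * 1 ^ (a + b - 1)) * (1 - p) ^ a := by
    rcases Nat.eq_zero_or_pos a with rfl | ha
    · have : (b : ℝ) < s := by
        have : (1 - p) * b < (1 - p) * s := by simpa using hab
        exact lt_of_mul_lt_mul_left this hq.le
      simpa using this
    · obtain ⟨c, rfl⟩ := Nat.exists_eq_succ_of_ne_zero ha.ne'
      have e : ((c.succ : ℕ) * (1 - p) ^ (c.succ - 1) * 1) * 1 ^ s +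
          (1 - p) ^ c.succ * (s * 1 ^ (s - 1)) -
          ((c.succ + b : ℕ) * 1 ^ (c.succ + b - 1)) * (1 - p) ^ c.succ =
          (1 - p) ^ c * (p * (c.succ : ℕ) + (1 - p) * s - (1 - p) * b) := by
        simp only [Nat.succ_eq_add_one, Nat.add_sub_cancel, one_pow]
        push_cast
        ring
      rw [e]
      exact mul_pos (pow_pos hq c) (by linarith)
  have hslope := (hasDerivAt_iff_tendsto_slope.1 hder).eventually_const_lt hpos
  have hslope' : ∀ᶠ z in 𝓝[>] (1 : ℝ), 0 < slope D 1 z :=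
    hslope.filter_mono (nhdsWithin_mono _ fun z hz => ne_of_gt hz)
  obtain ⟨z, hz, hz1⟩ := (hslope'.and self_mem_nhdsWithin).exists
  have hz1 : 1 < z := hz1
  have hD1 : D 1 = 0 := by simp [hD]
  have hDz : 0 < D z := by
    rw [slope_def_field, hD1, sub_zero] at hz
    exact (div_pos_iff_of_pos_right (by linarith)).1 hz
  refine ⟨z, hz1, ?_⟩
  have hzp : 0 < z - p := by linarith
  rw [div_pow, mul_div_assoc', div_lt_iff₀ (pow_pos hzp a), mul_pow]
  simp only [hD, pow_add] at hDz
  linarith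

variable {Ω : Type*} [MeasurableSpace Ω] {μ : Measure Ω} [IsProbabilityMeasure μ]
  {B : ℕ → ℕ → Ω → ℝ} {p : ℝ}

theorem integrable_pow_exitHeight (hBm : ∀ i j, Measurable (B i j)) {z : ℝ} (hz : 1 < z) (i j : ℕ) :
    Integrable (fun ω => z ^ exitHeight (fun k l => B k l ω) i j) μ := by
  have hm : Measurable fun ω => z ^ exitHeight (fun k l => B k l ω) i j :=
    (measurable_from_top (f := fun n : ℕ => z ^ n)).comp
      (measurable_exitHeight fun k l _ _ => hBm k l)
  refine Integrable.mono' (integrable_const (z ^ j)) hm.aestronglyMeasurable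
    (ae_of_all _ fun ω => ?_)
  rw [Real.norm_of_nonneg (by positivity)]
  exact pow_le_pow_right₀ hz.le (exitHeight_le i j)

/-- First-step analysis: the variable at the starting vertex is independent of the exit heights from
its two predecessors, which do not involve it. -/
theorem integral_pow_exitHeight_succ_succ (hBm : ∀ i j, Measurable (B i j))
    (hB : iIndepFun (fun k : ℕ × ℕ => B k.1 k.2) μ) (hB01 : ∀ i j ω, B i j ω = 0 ∨ B i j ω = 1)
    (hBp : ∀ i j, ∫ ω, B i j ω ∂μ = p) {z : ℝ} (hz : 1 < z) (i j : ℕ) :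
    ∫ ω, z ^ exitHeight (fun k l => B k l ω) (i + 1) (j + 1) ∂μ =
      p * ∫ ω, z ^ exitHeight (fun k l => B k l ω) (i + 1) j ∂μ +
      (1 - p) * ∫ ω, z ^ exitHeight (fun k l => B k l ω) i (j + 1) ∂μ := by
  set Z : ℕ → ℕ → Ω → ℝ := fun i j ω => z ^ exitHeight (fun k l => B k l ω) i j with hZ
  have hZi : ∀ i j, Integrable (Z i j) μ := fun i j => integrable_pow_exitHeight hBm hz i j
  set β := B (i + 1) (j + 1) with hβ
  have hindep : ∀ i' j', i' ≤ i + 1 → j' ≤ j + 1 → (i' ≤ i ∨ j' ≤ j) → IndepFun β (Z i' j') μ := by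
    intro i' j' hi hj hij
    have h := indep_iSup_of_disjoint (fun k : ℕ × ℕ => (hBm k.1 k.2).comap_le) hB
      (disjoint_compl_right (a := ({(i + 1, j + 1)} : Set (ℕ × ℕ))))
    have hle : ∀ (S : Set (ℕ × ℕ)) (k : ℕ × ℕ), k ∈ S →
        Measurable[⨆ k ∈ S, MeasurableSpace.comap (B k.1 k.2) inferInstance] (B k.1 k.2) :=
      fun S k hk => (comap_measurable (B k.1 k.2)).mono
        (le_iSup₂_of_le (f := fun (k : ℕ × ℕ) (_ : k ∈ S) =>
          MeasurableSpace.comap (B k.1 k.2) inferInstance) k hk le_rfl) le_rfl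
    have h1 := hle {(i + 1, j + 1)} (i + 1, j + 1) rfl
    have h2 : Measurable[⨆ k ∈ ({(i + 1, j + 1)} : Set (ℕ × ℕ))ᶜ,
        MeasurableSpace.comap (B k.1 k.2) inferInstance] (Z i' j') := by
      refine (measurable_from_top (f := fun n : ℕ => z ^ n)).comp
        (measurable_exitHeight fun k l hk hl => hle _ (k, l) ?_)
      simp only [Set.mem_compl_iff, Set.mem_singleton_iff, Prod.mk.injEq]
      omega
    exact indep_of_indep_of_le_left (indep_of_indep_of_le_right h h2.comap_le) h1.comap_le
  have hβi : Integrable β μ := by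
    refine Integrable.mono' (integrable_const 1) (hBm _ _).aestronglyMeasurable
      (ae_of_all _ fun ω => ?_)
    rcases hB01 (i + 1) (j + 1) ω with h | h <;> simp [hβ, h]
  have hmul : ∀ i' j', i' ≤ i + 1 → j' ≤ j + 1 → (i' ≤ i ∨ j' ≤ j) →
      Integrable (fun ω => β ω * Z i' j' ω) μ ∧ ∫ ω, β ω * Z i' j' ω ∂μ = p * ∫ ω, Z i' j' ω ∂μ := by
    intro i' j' hi hj hij
    have h := hindep i' j' hi hj hij
    refine ⟨h.integrable_mul hβi (hZi i' j'), ?_⟩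
    have := h.integral_mul_eq_mul_integral hβi.aestronglyMeasurable (hZi i' j').aestronglyMeasurable
    rw [hβ, hBp] at this
    exact this
  obtain ⟨i1, e1⟩ := hmul (i + 1) j le_rfl (by omega) (Or.inr le_rfl)
  obtain ⟨i2, e2⟩ := hmul i (j + 1) (by omega) le_rfl (Or.inl le_rfl)
  have hrec : ∀ ω, Z (i + 1) (j + 1) ω =
      β ω * Z (i + 1) j ω + (Z i (j + 1) ω - β ω * Z i (j + 1) ω) := by
    intro ω
    simp only [hZ, exitHeight_succ_succ]
    rcases hB01 (i + 1) (j + 1) ω with h | h <;> simp [hβ, h]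
  have hi3 : Integrable (fun ω => Z i (j + 1) ω - β ω * Z i (j + 1) ω) μ := (hZi i (j + 1)).sub i2
  calc ∫ ω, Z (i + 1) (j + 1) ω ∂μ
      = ∫ ω, (β ω * Z (i + 1) j ω + (Z i (j + 1) ω - β ω * Z i (j + 1) ω)) ∂μ := by
        simp only [hrec]
    _ = p * ∫ ω, Z (i + 1) j ω ∂μ + (1 - p) * ∫ ω, Z i (j + 1) ω ∂μ := by
        rw [integral_add i1 hi3, integral_sub (hZi i (j + 1)) i2, e1, e2]
        ring

/-- Both `1` and `z ^ j * r ^ i`, with `r = (1 - p) * z / (z - p)`, solve the first-step recursion,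
and their sum dominates the moment on both axes. -/
theorem integral_pow_exitHeight_le (hBm : ∀ i j, Measurable (B i j))
    (hB : iIndepFun (fun k : ℕ × ℕ => B k.1 k.2) μ) (hB01 : ∀ i j ω, B i j ω = 0 ∨ B i j ω = 1)
    (hBp : ∀ i j, ∫ ω, B i j ω ∂μ = p) (hp0 : 0 ≤ p) (hp : p < 1) {z : ℝ} (hz : 1 < z) (i j : ℕ) :
    ∫ ω, z ^ exitHeight (fun k l => B k l ω) i j ∂μ ≤ 1 + z ^ j * ((1 - p) * z / (z - p)) ^ i := by
  have hzp : 0 < z - p := by linarith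
  have hq : 0 < 1 - p := by linarith
  set r := (1 - p) * z / (z - p) with hr
  have hr0 : 0 ≤ r := by positivity
  have hrz : r * z = p * r + (1 - p) * z := by
    have : r * (z - p) = (1 - p) * z := div_mul_cancel₀ _ hzp.ne'
    linarith
  induction i generalizing j with
  | zero => simp
  | succ i ihi =>
    induction j with
    | zero =>
      simp only [exitHeight_zero_right, pow_zero, integral_const, probReal_univ, smul_eq_mul,
        mul_one, one_mul, le_add_iff_nonneg_right]
      positivity
    | succ j ihj =>
      rw [integral_pow_exitHeight_succ_succ hBm hB hB01 hBp hz]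
      calc _ ≤ p * (1 + z ^ j * r ^ (i + 1)) + (1 - p) * (1 + z ^ (j + 1) * r ^ i) := by
            gcongr
            exact ihi (j + 1)
        _ = 1 + z ^ j * r ^ i * (p * r + (1 - p) * z) := by ring
        _ = 1 + z ^ (j + 1) * r ^ (i + 1) := by rw [← hrz]; ring

/-- Markov's inequality for `z ^ exitHeight` bounds the exceptional probabilities by two geometric
sequences; Borel–Cantelli concludes. -/
theorem ae_eventually_exitHeight_le (hBm : ∀ i j, Measurable (B i j))
    (hB : iIndepFun (fun k : ℕ × ℕ => B k.1 k.2) μ) (hB01 : ∀ i j ω, B i j ω = 0 ∨ B i j ω = 1)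
    (hBp : ∀ i j, ∫ ω, B i j ω ∂μ = p) (hp0 : 0 ≤ p) (hp : p < 1) {a b s : ℕ} (hs : s ≠ 0)
    (hab : (1 - p) * b < p * a + (1 - p) * s) :
    ∀ᵐ ω ∂μ, ∀ᶠ t : ℕ in atTop,
      exitHeight (fun k l => B k l ω) (t * a) ((t + 1) * b) ≤ t * s := by
  obtain ⟨z, hz, hφ⟩ := exists_exponent hp hab
  have hzp : 0 < z - p := by linarith
  have hq : 0 < 1 - p := by linarith
  set r := (1 - p) * z / (z - p) with hr
  have hr0 : 0 ≤ r := by positivity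
  have hz0 : 0 < z := by linarith
  set A : ℕ → Set Ω := fun t =>
    {ω | t * s < exitHeight (fun k l => B k l ω) (t * a) ((t + 1) * b)} with hA
  have hbound : ∀ t, μ.real (A t) ≤ (1 / z ^ s) ^ t + z ^ b * (z ^ b * r ^ a / z ^ s) ^ t := by
    intro t
    have hmarkov := mul_meas_ge_le_integral_of_nonneg (μ := μ)
      (f := fun ω => z ^ exitHeight (fun k l => B k l ω) (t * a) ((t + 1) * b))
      (ae_of_all _ fun ω => by positivity) (integrable_pow_exitHeight hBm hz _ _) (z ^ (t * s))
    have hsub : A t ⊆ {ω | z ^ (t * s) ≤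
        z ^ exitHeight (fun k l => B k l ω) (t * a) ((t + 1) * b)} := fun ω hω =>
      pow_le_pow_right₀ hz.le (le_of_lt hω)
    have h1 : z ^ (t * s) * μ.real (A t) ≤ 1 + z ^ ((t + 1) * b) * r ^ (t * a) :=
      (mul_le_mul_of_nonneg_left (measureReal_mono hsub) (by positivity)).trans
        (hmarkov.trans (integral_pow_exitHeight_le hBm hB hB01 hBp hp0 hp hz _ _))
    have hzs : 0 < z ^ (t * s) := by positivity
    rw [mul_comm, ← le_div_iff₀ hzs] at h1
    refine h1.trans_eq ?_
    clear_value r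
    have e1 : (1 / z ^ s) ^ t = 1 / z ^ (t * s) := by rw [div_pow, one_pow, ← pow_mul, mul_comm]
    have e2 : (z ^ b * r ^ a / z ^ s) ^ t = z ^ (t * b) * r ^ (t * a) / z ^ (t * s) := by
      rw [div_pow, mul_pow, ← pow_mul, ← pow_mul, ← pow_mul, mul_comm b, mul_comm a, mul_comm s]
    rw [e1, e2, add_mul, one_mul, pow_add]
    ring
  have hsum : Summable fun t : ℕ => (1 / z ^ s) ^ t + z ^ b * (z ^ b * r ^ a / z ^ s) ^ t := by
    have hzs : 1 < z ^ s := one_lt_pow₀ hz hs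
    refine (summable_geometric_of_lt_one (by positivity) ?_).add
      ((summable_geometric_of_lt_one (by positivity) ?_).mul_left _)
    · rw [div_lt_one (by positivity)]
      exact hzs
    · rw [div_lt_one (by positivity)]
      exact hφ
  have hfin : ∑' t, μ (A t) ≠ ⊤ := by
    have h1 : Summable fun t => μ.real (A t) :=
      Summable.of_nonneg_of_le (fun t => measureReal_nonneg) hbound hsum
    have h2 := h1.tsum_ofReal_ne_top
    simpa [ofReal_measureReal] using h2
  filter_upwards [ae_eventually_notMem hfin] with ω hω
  filter_upwards [hω] with t ht
  exact not_lt.1 ht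

end ExitHeightBound

/-! ### The model -/

section Model

variable {Ω : Type*}

theorem passageH_transpose (B η : ℕ → ℕ → Ω → ℝ) (ω : Ω) (m n : ℕ) :
    passageH (fun i j ω => 1 - B j i ω) (fun i j => η j i) ω n m = passageV B η ω m n :=
  firstPassage_transpose (h := fun _ _ => 0) (v := verticalWeight B η ω) (Nat.zero_le _)
    (Nat.zero_le _)

theorem passage_transpose (B ξ η : ℕ → ℕ → Ω → ℝ) (ω : Ω) (m n : ℕ) :
    passage (fun i j ω => 1 - B j i ω) (fun i j => η j i) (fun i j => ξ j i) ω n m =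
      passage B ξ η ω m n := by
  have h := firstPassage_transpose (h := horizontalWeight B ξ ω) (v := verticalWeight B η ω)
    (Nat.zero_le m) (Nat.zero_le n)
  rw [passage, passage, ← h]
  congr 1
  funext i j
  simp [verticalWeight, horizontalWeight]

variable [MeasurableSpace Ω]

/-- Grouping an independent family into rows, via currying of product measures. It serves to pair
`B` and `ξ` at each vertex, so that their products are independent. -/
theorem iIndepFun_curry {ι κ : Type*} {μ : Measure Ω} {Z : ι → κ → Ω → ℝ}
    (hZ : ∀ i j, Measurable (Z i j)) (h : iIndepFun (fun q : ι × κ => Z q.1 q.2) μ) :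
    iIndepFun (fun i ω j => Z i j ω) μ := by
  have := h.isProbabilityMeasure
  have hprob : ∀ i j, IsProbabilityMeasure (μ.map (Z i j)) := fun i j =>
    Measure.isProbabilityMeasure_map (hZ i j).aemeasurable
  have hm : Measurable fun ω (q : ι × κ) => Z q.1 q.2 ω := measurable_pi_iff.2 fun q => hZ _ _
  rw [iIndepFun_iff_map_fun_eq_infinitePi_map fun i => measurable_pi_iff.2 (hZ i)]
  have h1 := (iIndepFun_iff_map_fun_eq_infinitePi_map fun q : ι × κ => hZ q.1 q.2).1 h
  have h2 : ∀ i, μ.map (fun ω j => Z i j ω) = Measure.infinitePi fun j => μ.map (Z i j) := fun i =>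
    (iIndepFun_iff_map_fun_eq_infinitePi_map fun j => hZ i j).1
      (h.precomp (g := fun j => (i, j)) (Prod.mk_right_injective i))
  have h3 := Measure.infinitePi_map_curry (fun i j => μ.map (Z i j))
  rw [← h1, Measure.map_map (MeasurableEquiv.measurable _) hm] at h3
  simp only [h2]
  exact h3

/-- The model with measurable variables that satisfy the pointwise constraints everywhere. -/
structure IsRegularModel (μ : Measure Ω) (p : ℝ) (B ξ η : ℕ → ℕ → Ω → ℝ) : Prop where
  indep : iIndepFun (jointFamily B ξ η) μ
  measurable_B : ∀ i j, Measurable (B i j)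
  measurable_ξ : ∀ i j, Measurable (ξ i j)
  measurable_η : ∀ i j, Measurable (η i j)
  zero_or_one : ∀ i j ω, B i j ω = 0 ∨ B i j ω = 1
  mean : ∀ i j, ∫ ω, B i j ω ∂μ = p
  ident_B : ∀ i j, IdentDistrib (B i j) (B 0 0) μ μ
  ident_ξ : ∀ i j, IdentDistrib (ξ i j) (ξ 0 0) μ μ
  ident_η : ∀ i j, IdentDistrib (η i j) (η 0 0) μ μ
  nonneg_ξ : ∀ i j ω, 0 ≤ ξ i j ω
  nonneg_η : ∀ i j ω, 0 ≤ η i j ω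
  integrable_ξ : ∀ i j, Integrable (ξ i j) μ
  integrable_η : ∀ i j, Integrable (η i j) μ

namespace IsRegularModel

variable {μ : Measure Ω} {p : ℝ} {B ξ η : ℕ → ℕ → Ω → ℝ}

theorem transpose [IsProbabilityMeasure μ] (M : IsRegularModel μ p B ξ η) :
    IsRegularModel μ (1 - p) (fun i j ω => 1 - B j i ω) (fun i j => η j i) (fun i j => ξ j i) where
  indep := by
    let e : (ℕ × ℕ) ⊕ (ℕ × ℕ) ⊕ (ℕ × ℕ) → (ℕ × ℕ) ⊕ (ℕ × ℕ) ⊕ (ℕ × ℕ)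
      | .inl k => .inl k.swap
      | .inr (.inl k) => .inr (.inr k.swap)
      | .inr (.inr k) => .inr (.inl k.swap)
    have he : Function.Injective e := by
      rintro (k | k | k) (l | l | l) h <;> simp_all [e]
    let g : (ℕ × ℕ) ⊕ (ℕ × ℕ) ⊕ (ℕ × ℕ) → ℝ → ℝ
      | .inl _ => fun x => 1 - x
      | .inr _ => fun x => x
    have hg : ∀ i, Measurable (g i) := by
      rintro (k | k) <;> simp only [g] <;> fun_prop
    convert (M.indep.precomp he).comp g hg using 1
    funext i
    rcases i with k | k | k <;> rfl
  measurable_B i j := (M.measurable_B j i).const_sub 1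
  measurable_ξ i j := M.measurable_η j i
  measurable_η i j := M.measurable_ξ j i
  zero_or_one i j ω := by rcases M.zero_or_one j i ω with h | h <;> simp [h]
  mean i j := by
    have hint : Integrable (B j i) μ := by
      refine Integrable.mono' (integrable_const 1) (M.measurable_B j i).aestronglyMeasurable
        (ae_of_all _ fun ω => ?_)
      rcases M.zero_or_one j i ω with h | h <;> simp [h]
    rw [integral_sub (integrable_const _) hint, M.mean]
    simp
  ident_B i j := (M.ident_B j i).comp (u := fun x => 1 - x) (by fun_prop)
  ident_ξ i j := M.ident_η j i
  ident_η i j := M.ident_ξ j i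
  nonneg_ξ i j := M.nonneg_η j i
  nonneg_η i j := M.nonneg_ξ j i
  integrable_ξ i j := M.integrable_η j i
  integrable_η i j := M.integrable_ξ j i

theorem horizontalWeight_nonneg (M : IsRegularModel μ p B ξ η) (ω : Ω) (i j : ℕ) :
    0 ≤ horizontalWeight B ξ ω i j := by
  rcases M.zero_or_one i j ω with h | h <;> simp [horizontalWeight, h, M.nonneg_ξ]

theorem verticalWeight_nonneg (M : IsRegularModel μ p B ξ η) (ω : Ω) (i j : ℕ) :
    0 ≤ verticalWeight B η ω i j := by
  rcases M.zero_or_one i j ω with h | h <;> simp [verticalWeight, h, M.nonneg_η]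

theorem measurable_horizontalWeight (M : IsRegularModel μ p B ξ η) (i j : ℕ) :
    Measurable fun ω => horizontalWeight B ξ ω i j :=
  (M.measurable_B i j).mul (M.measurable_ξ i j)

theorem integrable_horizontalWeight (M : IsRegularModel μ p B ξ η) (i j : ℕ) :
    Integrable (fun ω => horizontalWeight B ξ ω i j) μ := by
  refine Integrable.mono (M.integrable_ξ i j)
    (M.measurable_horizontalWeight i j).aestronglyMeasurable (ae_of_all _ fun ω => ?_)
  rcases M.zero_or_one i j ω with h | h <;> simp [horizontalWeight, h]

theorem ident_horizontalWeight [IsProbabilityMeasure μ] (M : IsRegularModel μ p B ξ η) (i j : ℕ) :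
    IdentDistrib (fun ω => horizontalWeight B ξ ω i j) (fun ω => horizontalWeight B ξ ω 0 0) μ μ :=
  ((M.ident_B i j).prodMk (M.ident_ξ i j)
    (M.indep.indepFun (i := .inl (i, j)) (j := .inr (.inl (i, j))) (by simp))
    (M.indep.indepFun (i := .inl (0, 0)) (j := .inr (.inl (0, 0))) (by simp))).comp
    (u := fun q : ℝ × ℝ => q.1 * q.2) (by fun_prop)

theorem indep_horizontalWeight (M : IsRegularModel μ p B ξ η) :
    iIndepFun (fun (k : ℕ × ℕ) ω => horizontalWeight B ξ ω k.1 k.2) μ := by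
  let e : (ℕ × ℕ) × Bool → (ℕ × ℕ) ⊕ (ℕ × ℕ) ⊕ (ℕ × ℕ)
    | (k, true) => .inl k
    | (k, false) => .inr (.inl k)
  have he : Function.Injective e := by
    rintro ⟨k, _ | _⟩ ⟨l, _ | _⟩ h <;> simp_all [e]
  have h1 := iIndepFun_curry (Z := fun k c => jointFamily B ξ η (e (k, c))) (μ := μ) (by
    rintro k (_ | _)
    · exact M.measurable_ξ _ _
    · exact M.measurable_B _ _) (M.indep.precomp he)
  exact h1.comp (fun _ (x : Bool → ℝ) => x true * x false) fun _ => by fun_prop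

theorem indep_B (M : IsRegularModel μ p B ξ η) : iIndepFun (fun k : ℕ × ℕ => B k.1 k.2) μ :=
  M.indep.precomp (g := Sum.inl) Sum.inl_injective

/-- The strong law for the weights of the vertical axis. -/
theorem ae_tendsto_vertical [IsProbabilityMeasure μ] (M : IsRegularModel μ p B ξ η) :
    ∃ c : ℝ, 0 ≤ c ∧ ∀ᵐ ω ∂μ, Tendsto (fun k : ℕ =>
      (∑ l ∈ Finset.range k, verticalWeight B η ω 0 (l + 1)) / k) atTop (𝓝 c) := by
  refine ⟨_, ?_, strong_law_ae_real (fun l ω => verticalWeight B η ω 0 (l + 1))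
    (M.transpose.integrable_horizontalWeight 1 0) (fun k l hkl => ?_) fun l => ?_⟩
  · exact integral_nonneg fun ω => M.verticalWeight_nonneg ω 0 1
  · exact M.transpose.indep_horizontalWeight.indepFun (i := (k + 1, 0)) (j := (l + 1, 0))
      (by simpa using hkl)
  · exact (M.transpose.ident_horizontalWeight (l + 1) 0).trans
      (M.transpose.ident_horizontalWeight 1 0).symm

theorem passageH_le_passage (M : IsRegularModel μ p B ξ η) (ω : Ω) (m n : ℕ) :
    passageH B ξ ω m n ≤ passage B ξ η ω m n :=
  firstPassage_mono (fun _ _ => le_rfl) (M.verticalWeight_nonneg ω) (Nat.zero_le _) (Nat.zero_le _)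

theorem passageV_le_passage (M : IsRegularModel μ p B ξ η) (ω : Ω) (m n : ℕ) :
    passageV B η ω m n ≤ passage B ξ η ω m n :=
  firstPassage_mono (M.horizontalWeight_nonneg ω) (fun _ _ => le_rfl) (Nat.zero_le _) (Nat.zero_le _)

theorem passageArray_horizontalWeight (M : IsRegularModel μ p B ξ η) (ω : Ω) (a b m n : ℕ) :
    passageArray (fun k => horizontalWeight B ξ ω k.1 k.2) a b m n =
      firstPassage (horizontalWeight B ξ ω) (fun _ _ => 0) a b m n := by
  simp only [passageArray, max_eq_left (M.horizontalWeight_nonneg ω _ _)]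

/-- An almost sure property of the product measure holds for the horizontal weights. -/
theorem ae_horizontalWeight [IsProbabilityMeasure μ] (M : IsRegularModel μ p B ξ η)
    {q : (ℕ × ℕ → ℝ) → Prop}
    (hq : ∀ᵐ u ∂(Measure.infinitePi fun _ : ℕ × ℕ => μ.map fun ω => horizontalWeight B ξ ω 0 0),
      q u) : ∀ᵐ ω ∂μ, q fun k => horizontalWeight B ξ ω k.1 k.2 := by
  have h1 := (iIndepFun_iff_map_fun_eq_infinitePi_map fun k : ℕ × ℕ =>
    M.measurable_horizontalWeight k.1 k.2).1 M.indep_horizontalWeight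
  have h2 : (fun k : ℕ × ℕ => μ.map fun ω => horizontalWeight B ξ ω k.1 k.2) =
      fun _ => μ.map fun ω => horizontalWeight B ξ ω 0 0 :=
    funext fun k => (M.ident_horizontalWeight k.1 k.2).map_eq
  rw [h2] at h1
  rw [← h1] at hq
  exact ae_of_ae_map (measurable_pi_iff.2 fun k : ℕ × ℕ =>
    M.measurable_horizontalWeight k.1 k.2).aemeasurable hq

/-- Blocks of size `(a, b)` bound the passage value from above in a direction `(x, y)` in which
the backward paths of weight zero reach the horizontal axis. -/
theorem eventually_passage_div_lt (M : IsRegularModel μ p B ξ η) {x y : ℝ} (hx : 0 ≤ x)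
    (hy : 0 ≤ y) {N a b s : ℕ} (hN : N ≠ 0) (ha : N * x < a) (hb : b ≤ N * y) {c e : ℝ} {ω : Ω}
    (hJ : ∀ᶠ t : ℕ in atTop, exitHeight (fun k l => B k l ω) (t * ⌊(N : ℝ) * x⌋₊)
      ((t + 1) * (⌊(N : ℝ) * y⌋₊ + 1)) ≤ t * s)
    (hs : s ≠ 0)
    (hc : Tendsto (fun k : ℕ =>
      (∑ l ∈ Finset.range k, verticalWeight B η ω 0 (l + 1)) / k) atTop (𝓝 c))
    (he : Tendsto (fun k : ℕ => (∑ t ∈ Finset.range k,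
      firstPassage (horizontalWeight B ξ ω) (fun _ _ => 0) (t * a) (t * b) ((t + 1) * a)
        ((t + 1) * b)) / k) atTop (𝓝 e))
    {δ : ℝ} (hδ : (e + s * c) / N < δ) :
    ∀ᶠ n : ℕ in atTop, passage B ξ η ω ⌊(n : ℝ) * x⌋₊ ⌊(n : ℝ) * y⌋₊ / n < δ := by
  set J := exitHeight fun k l => B k l ω with hJdef
  set a' := ⌊(N : ℝ) * x⌋₊ with ha'
  set b' := ⌊(N : ℝ) * y⌋₊ + 1 with hb'
  have haa : a' ≤ a := by
    have : (a' : ℝ) ≤ N * x := Nat.floor_le (by positivity)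
    exact_mod_cast this.trans ha.le
  have hbb : b ≤ b' := by
    have : (N : ℝ) * y < b' := by exact_mod_cast Nat.lt_floor_add_one ((N : ℝ) * y)
    exact_mod_cast hb.trans this.le
  obtain ⟨t₀, ht₀⟩ := eventually_atTop.1 hJ
  -- The finitely many early blocks, where the almost sure bound may fail, have exit height at most
  -- `(t₀ + 1) * b'`.
  set C := (t₀ + 1) * b' with hC
  have hJC : ∀ t T, t ≤ T → J (t * a') ((t + 1) * b') ≤ T * s + C := by
    intro t T htT
    rcases le_total t₀ t with h | h
    · exact (ht₀ t h).trans ((Nat.mul_le_mul_right s htT).trans (Nat.le_add_right _ _))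
    · exact (exitHeight_le _ _).trans
        ((Nat.mul_le_mul_right b' (Nat.succ_le_succ h)).trans (Nat.le_add_left _ _))
  have hA : Tendsto (fun k : ℕ =>
      (∑ l ∈ Finset.range (k * s + C), verticalWeight B η ω 0 (l + 1)) / k) atTop
      (𝓝 (c * s)) := by
    have h1 : Tendsto (fun k : ℕ => k * s + C) atTop atTop :=
      tendsto_atTop_mono (fun k => Nat.le_add_right _ _)
        (tendsto_id.atTop_mul_const' (Nat.pos_of_ne_zero hs))
    have h2 : Tendsto (fun k : ℕ => (s : ℝ) + C / (k : ℝ)) atTop (𝓝 (s + 0)) :=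
      tendsto_const_nhds.add (tendsto_const_div_atTop_nhds_zero_nat _)
    rw [add_zero] at h2
    refine ((hc.comp h1).mul h2).congr' ?_
    filter_upwards [eventually_gt_atTop 0] with k hk
    have hk' : (0 : ℝ) < k := by exact_mod_cast hk
    have : (0 : ℝ) < k * s + C := by positivity
    simp only [Function.comp_apply]
    push_cast
    field_simp
  have hlim := (tendsto_comp_natDiv he hN).add (tendsto_comp_natDiv (u := fun k =>
    ∑ l ∈ Finset.range (k * s + C), verticalWeight B η ω 0 (l + 1)) hA hN)
  have hδ' : e / N + c * s / N < δ := by rwa [← add_div, mul_comm c]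
  filter_upwards [hlim.eventually_lt_const hδ', eventually_floor_le_natDiv_mul hN ha] with n hn hna
  refine lt_of_le_of_lt ?_ hn
  rw [← add_div]
  gcongr
  have hJend : J ⌊(n : ℝ) * x⌋₊ ⌊(n : ℝ) * y⌋₊ ≤ n / N * s + C := by
    refine (exitHeight_mono (natDiv_mul_le_floor hx (Nat.floor_le (by positivity)) n) ?_).trans
      (hJC (n / N) (n / N) le_rfl)
    refine Nat.floor_le_of_le ?_
    have h1 : (n : ℝ) ≤ ((n / N + 1 : ℕ) : ℝ) * N := by
      have := Nat.lt_mul_div_succ n (Nat.pos_of_ne_zero hN)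
      rw [mul_comm] at this
      exact_mod_cast this.le
    have h2 : (N : ℝ) * y ≤ b' := by exact_mod_cast (Nat.lt_floor_add_one ((N : ℝ) * y)).le
    calc (n : ℝ) * y ≤ ((n / N + 1 : ℕ) : ℝ) * N * y := by gcongr
      _ = ((n / N + 1 : ℕ) : ℝ) * (N * y) := by ring
      _ ≤ ((n / N + 1 : ℕ) : ℝ) * b' := by gcongr
      _ = (((n / N + 1) * b' : ℕ) : ℝ) := by push_cast; ring
  have h := firstPassage_le_sum_blocks (B := fun k l => B k l ω) (M.horizontalWeight_nonneg ω)
    (M.verticalWeight_nonneg ω) (fun i j h => by simp [verticalWeight, h])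
    (fun i j h => by simp [horizontalWeight, (M.zero_or_one i j ω).resolve_right h])
    (s := n / N * s + C) (T := n / N) (a := a) (b := b)
    (fun t ht => (exitHeight_mono (Nat.mul_le_mul_left t haa)
      (Nat.mul_le_mul_left (t + 1) hbb)).trans (hJC t (n / N) ht.le))
    hna (natDiv_mul_le_floor hy hb n)
  rwa [max_eq_left hJend] at h

/-- The lower bound is `F_H ≤ F`. On the horizontal axis, and almost surely for `p = 1`, the two
values agree; otherwise the block bound applies with ever larger `N`. -/
theorem exists_limitShape_horizontal [IsProbabilityMeasure μ] (M : IsRegularModel μ p B ξ η)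
    (hp0 : 0 ≤ p) (hp1 : p ≤ 1) : ∃ f : ℝ → ℝ → ℝ, IsLimitShape μ (passageH B ξ) f ∧
    ∀ x y : ℝ, 0 ≤ x → 0 ≤ y → (1 - p) * y ≤ p * x → ∀ᵐ ω ∂μ, Tendsto (fun n : ℕ =>
      passage B ξ η ω ⌊(n : ℝ) * x⌋₊ ⌊(n : ℝ) * y⌋₊ / (n : ℝ)) atTop (𝓝 (f x y)) := by
  set ν := μ.map fun ω => horizontalWeight B ξ ω 0 0 with hν
  have hm0 := M.measurable_horizontalWeight 0 0
  have : IsProbabilityMeasure ν := Measure.isProbabilityMeasure_map hm0.aemeasurable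
  have hνi : Integrable (fun x => x) ν :=
    (integrable_map_measure measurable_id.aestronglyMeasurable hm0.aemeasurable).2
      (M.integrable_horizontalWeight 0 0)
  obtain ⟨f, hf, happ⟩ := exists_limitShape_array hνi
  have hfH : IsLimitShape μ (passageH B ξ) f := by
    intro x y hx hy
    filter_upwards [M.ae_horizontalWeight (hf x y hx hy)] with ω hω
    simpa only [M.passageArray_horizontalWeight, passageH] using hω
  refine ⟨f, hfH, fun x y hx hy hxy => ?_⟩
  rcases hy.eq_or_lt with rfl | hy
  · filter_upwards [hfH x 0 hx le_rfl] with ω hω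
    refine hω.congr fun n => ?_
    congr 1
    simp only [mul_zero, Nat.floor_zero]
    exact firstPassage_congr_on_axis (Nat.zero_le _)
  rcases hp1.eq_or_lt with rfl | hp
  · have hB1 : ∀ᵐ ω ∂μ, ∀ i j, B i j ω = 1 := by
      refine ae_all_iff.2 fun i => ae_all_iff.2 fun j => ?_
      have h1 : ∫ ω, 1 - B i j ω ∂μ = 0 := by simpa using M.transpose.mean j i
      have h2 : Integrable (fun ω => 1 - B i j ω) μ := by
        refine Integrable.mono' (integrable_const 1)
          ((M.measurable_B i j).const_sub 1).aestronglyMeasurable (ae_of_all _ fun ω => ?_)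
        rcases M.zero_or_one i j ω with h | h <;> simp [h]
      have h3 := (integral_eq_zero_iff_of_nonneg (fun ω => by
        rcases M.zero_or_one i j ω with h | h <;> simp [h]) h2).1 h1
      filter_upwards [h3] with ω hω
      have : 1 - B i j ω = 0 := hω
      linarith
    filter_upwards [hfH x y hx hy.le, hB1] with ω hω hω1
    refine hω.congr fun n => ?_
    have : verticalWeight B η ω = fun _ _ => 0 := by
      funext i j
      simp [verticalWeight, hω1]
    rw [passage, this, passageH]
  have hq : 0 < 1 - p := by linarith
  -- Rounding in both coordinates costs at most `(1 - p) + p = 1` in `hab`, so `(1 - p) * s > 1`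
  -- gives strict inequality for every `N`, even in the critical direction.
  obtain ⟨s, hs⟩ := exists_nat_gt (1 / (1 - p))
  rw [div_lt_iff₀ hq] at hs
  have hs0 : s ≠ 0 := by
    rintro rfl
    norm_num at hs
  obtain ⟨c, hc0, hc⟩ := M.ae_tendsto_vertical
  have hup : ∀ k : ℕ, ∀ᵐ ω ∂μ, ∀ δ, f x y + 2 / (k + 1 : ℝ) < δ → ∀ᶠ n : ℕ in atTop,
      passage B ξ η ω ⌊(n : ℝ) * x⌋₊ ⌊(n : ℝ) * y⌋₊ / n < δ := by
    intro k
    have hk : (0 : ℝ) < 1 / (k + 1 : ℝ) := by positivity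
    -- With `N > s * c * (k + 1)` the axis term `s * c / N` is below `1 / (k + 1)`; the
    -- approximation of `f x y` costs the other `1 / (k + 1)`.
    obtain ⟨N, a, b, hK, hN, ha, hb, hmean⟩ := happ x y hx hy _ hk (s * c * (k + 1))
    have hN' : (0 : ℝ) < N := by positivity
    have hab : (1 - p) * ((⌊(N : ℝ) * y⌋₊ + 1 : ℕ) : ℝ) <
        p * (⌊(N : ℝ) * x⌋₊ : ℝ) + (1 - p) * s := by
      have h1 : (⌊(N : ℝ) * y⌋₊ : ℝ) ≤ N * y := Nat.floor_le (by positivity)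
      have h2 := (Nat.lt_floor_add_one ((N : ℝ) * x)).le
      have h3 : (1 - p) * (⌊(N : ℝ) * y⌋₊ : ℝ) ≤ (1 - p) * (N * y) := by gcongr
      have h4 : p * (N * x) ≤ p * (⌊(N : ℝ) * x⌋₊ + 1) := by gcongr
      have h5 : (N : ℝ) * ((1 - p) * y) ≤ N * (p * x) := by gcongr
      push_cast
      linarith
    filter_upwards [ae_eventually_exitHeight_le M.measurable_B M.indep_B M.zero_or_one M.mean hp0 hp
      hs0 hab, hc, M.ae_horizontalWeight (ae_tendsto_sum_blocks hνi a b)] with ω h1 h2 h3 δ hδ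
    simp only [M.passageArray_horizontalWeight] at h3
    refine M.eventually_passage_div_lt hx hy.le hN ha hb h1 hs0 h2 h3 (lt_of_le_of_lt ?_ hδ)
    rw [div_le_iff₀ hN']
    have h4 : (s : ℝ) * c ≤ 1 / (k + 1 : ℝ) * N := by
      rw [one_div_mul_eq_div, le_div_iff₀ (by positivity)]
      exact hK.le
    have h5 : 2 / (k + 1 : ℝ) = 1 / (k + 1 : ℝ) + 1 / (k + 1 : ℝ) := by ring
    rw [h5]
    linarith
  filter_upwards [hfH x y hx hy.le, ae_all_iff.2 hup] with ω h1 h2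
  refine tendsto_order.2 ⟨fun δ hδ => ?_, fun δ hδ => ?_⟩
  · filter_upwards [h1.eventually_const_lt hδ] with n hn
    refine hn.trans_le ?_
    gcongr
    exact M.passageH_le_passage ω _ _
  · have h3 : Tendsto (fun k : ℕ => f x y + 2 / ((k : ℝ) + 1)) atTop (𝓝 (f x y + 0)) := by
      refine tendsto_const_nhds.add ?_
      have := (tendsto_const_div_atTop_nhds_zero_nat (2 : ℝ)).comp (tendsto_add_atTop_nat 1)
      refine this.congr fun k => ?_
      simp
    rw [add_zero] at h3
    obtain ⟨k, hk⟩ := (h3.eventually_lt_const hδ).exists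
    exact h2 k δ hk

theorem exists_limitShapes [IsProbabilityMeasure μ] (M : IsRegularModel μ p B ξ η)
    (hp0 : 0 ≤ p) (hp1 : p ≤ 1) : ∃ f fH fV : ℝ → ℝ → ℝ,
    IsLimitShape μ (passage B ξ η) f ∧ IsLimitShape μ (passageH B ξ) fH ∧
    IsLimitShape μ (passageV B η) fV ∧ ∀ x y : ℝ, 0 ≤ x → 0 ≤ y →
      f x y = max (fH x y) (fV x y) ∧ ((1 - p) * y ≤ p * x → f x y = fH x y) ∧
      (p * x < (1 - p) * y → f x y = fV x y) := by
  classical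
  obtain ⟨fH, hH, hfH⟩ := M.exists_limitShape_horizontal hp0 hp1
  obtain ⟨fV, hV, hfV⟩ := M.transpose.exists_limitShape_horizontal (by linarith) (by linarith)
  have hV' : IsLimitShape μ (passageV B η) fun x y => fV y x := by
    intro x y hx hy
    simpa only [passageH_transpose] using hV y x hy hx
  have hf : IsLimitShape μ (passage B ξ η)
      fun x y => if (1 - p) * y ≤ p * x then fH x y else fV y x := by
    intro x y hx hy
    beta_reduce
    split_ifs with h
    · exact hfH x y hx hy h
    · simpa only [passage_transpose] using hfV y x hy hx (by linarith)
  refine ⟨_, fH, fun x y => fV y x, hf, hH, hV', fun x y hx hy => ⟨?_, fun h => if_pos h,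
    fun h => if_neg (not_le.2 h)⟩⟩
  obtain ⟨ω, h1, h2, h3⟩ := ((hf x y hx hy).and ((hH x y hx hy).and (hV' x y hx hy))).exists
  have hle1 := le_of_tendsto_of_tendsto' h2 h1 fun n => by
    gcongr
    exact M.passageH_le_passage ω _ _
  have hle2 := le_of_tendsto_of_tendsto' h3 h1 fun n => by
    gcongr
    exact M.passageV_le_passage ω _ _
  beta_reduce at hle1 hle2 ⊢
  split_ifs at hle1 hle2 ⊢ with h
  · exact (max_eq_left hle2).symm
  · exact (max_eq_right hle1).symm

end IsRegularModel

/-- Versions on a set of full measure make the deterministic splicing valid at every `ω` and all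
functions measurable; the limit shapes do not see the change. -/
theorem exists_regularModel (μ : Measure Ω) [IsProbabilityMeasure μ]
    (p : unitInterval) (B ξ η : ℕ → ℕ → Ω → ℝ)
    (hindep : iIndepFun (jointFamily B ξ η) μ)
    (hB : ∀ i j, HasLaw (B i j) (bernoulliMeasure (1 : ℝ) 0 p) μ)
    (hξ_ident : ∀ i j, IdentDistrib (ξ i j) (ξ 0 0) μ μ)
    (hη_ident : ∀ i j, IdentDistrib (η i j) (η 0 0) μ μ)
    (hξ_nonneg : ∀ i j, ∀ᵐ ω ∂μ, 0 ≤ ξ i j ω)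
    (hη_nonneg : ∀ i j, ∀ᵐ ω ∂μ, 0 ≤ η i j ω)
    (hξ_int : ∀ i j, Integrable (ξ i j) μ)
    (hη_int : ∀ i j, Integrable (η i j) μ) :
    ∃ B' ξ' η' : ℕ → ℕ → Ω → ℝ, IsRegularModel μ p B' ξ' η' ∧ (∀ i j, B i j =ᵐ[μ] B' i j) ∧
      (∀ i j, ξ i j =ᵐ[μ] ξ' i j) ∧ ∀ i j, η i j =ᵐ[μ] η' i j := by
  classical
  have hmod : ∀ X : Ω → ℝ, Integrable X μ → (∀ᵐ ω ∂μ, 0 ≤ X ω) →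
      ∃ X' : Ω → ℝ, Measurable X' ∧ (∀ ω, 0 ≤ X' ω) ∧ X =ᵐ[μ] X' := by
    intro X hX hX0
    refine ⟨fun ω => max (hX.aemeasurable.mk X ω) 0, hX.aemeasurable.measurable_mk.max
      measurable_const, fun ω => le_max_right _ _, ?_⟩
    filter_upwards [hX0, hX.aemeasurable.ae_eq_mk] with ω h1 h2
    rw [← h2, max_eq_left h1]
  have hmodB : ∀ i j, ∃ X' : Ω → ℝ, Measurable X' ∧ (∀ ω, X' ω = 0 ∨ X' ω = 1) ∧
      B i j =ᵐ[μ] X' := by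
    intro i j
    have hm := (hB i j).aemeasurable
    have h01 : ∀ᵐ ω ∂μ, B i j ω = 0 ∨ B i j ω = 1 := by
      refine ae_of_ae_map hm (p := fun x => x = 0 ∨ x = 1) ?_
      rw [(hB i j).map_eq, bernoulliMeasure_def, ae_add_measure_iff]
      constructor
      · exact Measure.ae_smul_measure (by rw [ae_dirac_eq]; simp) _
      · exact Measure.ae_smul_measure (by rw [ae_dirac_eq]; simp) _
    refine ⟨fun ω => if hm.mk (B i j) ω = 1 then 1 else 0,
      Measurable.ite (hm.measurable_mk (measurableSet_singleton 1)) measurable_const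
        measurable_const, fun ω => ?_, ?_⟩
    · beta_reduce
      split_ifs <;> simp
    · filter_upwards [h01, hm.ae_eq_mk] with ω h1 h2
      rw [← h2]
      rcases h1 with h1 | h1 <;> simp [h1]
  choose B' hB'm hB'01 hB' using hmodB
  choose ξ' hξ'm hξ'0 hξ' using fun i j => hmod (ξ i j) (hξ_int i j) (hξ_nonneg i j)
  choose η' hη'm hη'0 hη' using fun i j => hmod (η i j) (hη_int i j) (hη_nonneg i j)
  have hid : ∀ {X X' Y Y' : Ω → ℝ}, IdentDistrib X Y μ μ → X =ᵐ[μ] X' → Y =ᵐ[μ] Y' →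
      Measurable X' → Measurable Y' → IdentDistrib X' Y' μ μ := by
    intro X X' Y Y' h hX hY hX' hY'
    exact ⟨hX'.aemeasurable, hY'.aemeasurable, by
      rw [← Measure.map_congr hX, ← Measure.map_congr hY, h.map_eq]⟩
  refine ⟨B', ξ', η', ?_, hB', hξ', hη'⟩
  exact
    { indep := by
        refine (iIndepFun_congr ?_).1 hindep
        rintro (k | k | k)
        exacts [hB' _ _, hξ' _ _, hη' _ _]
      measurable_B := hB'm
      measurable_ξ := hξ'm
      measurable_η := hη'm
      zero_or_one := hB'01
      mean := fun i j => by
        rw [← integral_congr_ae (hB' i j)]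
        have := integral_map (hB i j).aemeasurable (f := fun x : ℝ => x) (by fun_prop)
        rw [← this, (hB i j).map_eq, integral_bernoulliMeasure]
        simp
      ident_B := fun i j => hid ⟨(hB i j).aemeasurable, (hB 0 0).aemeasurable, by
        rw [(hB i j).map_eq, (hB 0 0).map_eq]⟩ (hB' i j) (hB' 0 0) (hB'm i j) (hB'm 0 0)
      ident_ξ := fun i j => hid (hξ_ident i j) (hξ' i j) (hξ' 0 0) (hξ'm i j) (hξ'm 0 0)
      ident_η := fun i j => hid (hη_ident i j) (hη' i j) (hη' 0 0) (hη'm i j) (hη'm 0 0)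
      nonneg_ξ := hξ'0
      nonneg_η := hη'0
      integrable_ξ := fun i j => (hξ_int i j).congr (hξ' i j)
      integrable_η := fun i j => (hη_int i j).congr (hη' i j) }

theorem IsLimitShape.congr {μ : Measure Ω} {F G : Ω → ℕ → ℕ → ℝ} {f : ℝ → ℝ → ℝ}
    (hF : IsLimitShape μ F f) (h : ∀ᵐ ω ∂μ, F ω = G ω) : IsLimitShape μ G f := by
  intro x y hx hy
  filter_upwards [hF x y hx hy, h] with ω h1 h2
  rwa [h2] at h1

end Model

theorem theorem1 {Ω : Type*} [MeasurableSpace Ω] (μ : Measure Ω) [IsProbabilityMeasure μ]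
    (p : unitInterval) (B ξ η : ℕ → ℕ → Ω → ℝ)
    (hindep : iIndepFun (jointFamily B ξ η) μ)
    (hB : ∀ i j, HasLaw (B i j) (bernoulliMeasure (1 : ℝ) 0 p) μ)
    (hξ_ident : ∀ i j, IdentDistrib (ξ i j) (ξ 0 0) μ μ)
    (hη_ident : ∀ i j, IdentDistrib (η i j) (η 0 0) μ μ)
    (hξ_nonneg : ∀ i j, ∀ᵐ ω ∂μ, 0 ≤ ξ i j ω)
    (hη_nonneg : ∀ i j, ∀ᵐ ω ∂μ, 0 ≤ η i j ω)
    (hξ_int : ∀ i j, Integrable (ξ i j) μ)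
    (hη_int : ∀ i j, Integrable (η i j) μ) :
    ∃ f fH fV : ℝ → ℝ → ℝ,
      IsLimitShape μ (passage B ξ η) f ∧
      IsLimitShape μ (passageH B ξ) fH ∧
      IsLimitShape μ (passageV B η) fV ∧
      ∀ x y : ℝ, 0 ≤ x → 0 ≤ y →
        f x y = max (fH x y) (fV x y) ∧
        ((1 - (p : ℝ)) * y ≤ (p : ℝ) * x → f x y = fH x y) ∧
        ((p : ℝ) * x < (1 - (p : ℝ)) * y → f x y = fV x y) := by
  obtain ⟨B', ξ', η', M, hB', hξ', hη'⟩ := exists_regularModel μ p B ξ η hindep hB hξ_ident hη_ident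
    hξ_nonneg hη_nonneg hξ_int hη_int
  obtain ⟨f, fH, fV, hf, hfH, hfV, h⟩ := M.exists_limitShapes p.2.1 p.2.2
  have hall : ∀ᵐ ω ∂μ, ∀ i j, B i j ω = B' i j ω ∧ ξ i j ω = ξ' i j ω ∧ η i j ω = η' i j ω :=
    ae_all_iff.2 fun i => ae_all_iff.2 fun j => (hB' i j).and ((hξ' i j).and (hη' i j))
  refine ⟨f, fH, fV, hf.congr ?_, hfH.congr ?_, hfV.congr ?_, h⟩
  all_goals
    filter_upwards [hall] with ω hω
    funext m n
    simp only [passage, passageH, passageV]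
    congr 1 <;> funext i j <;> simp [horizontalWeight, verticalWeight, hω i j]
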